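/- Let $\phi(x)=2^{1/4}e^{-\pi x^2}$ and, for $f\in L^2(\mathbb R)$, let $V_\phi f(\omega,t)=\int_{\mathbb R} f(x)\overline{\phi(x-t)}e^{-2\pi i\omega x}\,dx$ be the Short-Time Fourier Transform with Gaussian window $\phi$. For a bounded measurable set $E\subseteq\mathbb R^2$, Daubechies' localization operator $P_E$ on $L^2(\mathbb R)$ is the bounded operator defined weakly by $$\langle P_E f,g\rangle=\int_E V_\phi f\;\overline{V_\phi g}\,d\omega\,dt\qquad\text{for all } f,g\in L^2(\mathbb R).$$ For a base $M\in\mathbb N$, an alphabet $\mathcal A\subseteq\{0,1,\dots,M-1\}$, $n\ge 0$ and $L>0$, put $$\mathcal C_n^{(d)}(M,\mathcal A)=\Big\{\sum_{j=0}^{n-1}a_jM^j : a_j\in\mathcal A\Big\},\qquad C_n(L,M,\mathcal A)=\bigcup_{x\in \mathcal C_n^{(d)}(M,\mathcal A)}\big[LM^{-n}x,\;LM^{-n}(x+1)\big],$$ and, for $R>0$, let $\mathcal C_n(R,M,\mathcal A)=\{(\omega,t)\in\mathbb R^2:\omega^2+t^2\in C_n(R^2,M,\mathcal A)\}$ be the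 spherically symmetric $n$-iterate Cantor set in the disk of radius $R$. **Theorem.** Let $M$ and $m$ be integers with $0<m<M$, and let $\overline{\mathcal A}=\{0,1,\dots,m-1\}$ be the canonical alphabet of size $m$. There are finite constants $0<B_L\le B_U$, depending only on $M$ and $m$, such that the following holds for every sequence of radii $R(n)>0$ with $R(n)\to\infty$ as $n\to\infty$ and $\pi R(n)^2\le M^n$ for all $n=0,1,2,\dots$ (a) For every alphabet $\mathcal A\subseteq\{0,\dots,M-1\}$ of size $|\mathcal A|=m$ and every $n\ge0$, $$\|P_{\mathcal C_n(R(n),M,\mathcal A)}\|_{\mathrm{op}}\le B_U\left(\frac mM\right)^n\big(\pi R(n)^2\big)^{1-\frac{\ln m}{\ln M}}.$$ (b) For the canonical alphabet, for every $n$ with $\pi R(n)^2\ge1$ (hence for all sufficiently large $n$), $$\|P_{\mathcal C_n(R(n),M,\overline{\mathcal A})}\|_{\mathrm{op}}\ge B_L\left(\frac mM\right)^n\big(\pi R(n)^2\big)^{1-\frac{\ln m}{\ln M}}.$$ (c) There is an alphabet of size $m$, namely the reverse canonical alphabet $\underline{\mathcal A}=\{M-1,M-2,\dots,M-m\}\subseteq\{0,\dots,M-1\}$,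 such that $$\|P_{\mathcal C_n(R(n),M,\underline{\mathcal A})}\|_{\mathrm{op}}\cdot\|P_{\mathcal C_n(R(n),M,\overline{\mathcal A})}\|_{\mathrm{op}}^{-1}\to0\qquad\text{as } n\to\infty.$$ -/

import Mathlib

open MeasureTheory

noncomputable section

namespace Daubechies

/-- The Hilbert space `L²(ℝ)` of complex-valued signals. -/
abbrev Signal : Type := Lp ℂ 2 (volume : Measure ℝ)

/-- The normalized Gaussian window `φ(x) = 2^{1/4} e^{-π x²}`. -/
def gaussianWindow (x : ℝ) : ℝ :=
  (2 : ℝ) ^ (1 / 4 : ℝ) * Real.exp (-Real.pi * x ^ 2)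

/-- The Short-Time Fourier Transform
`V f (ω, t) = ∫ f(x) conj(φ(x - t)) e^{-2π i ω x} dx`, with the Gaussian window `φ`.
The window is real-valued, so that it equals its complex conjugate. -/
def stft (f : ℝ → ℂ) (p : ℝ × ℝ) : ℂ :=
  ∫ x : ℝ, f x * (gaussianWindow (x - p.2) : ℂ) *
    Complex.exp (-(2 * Real.pi * p.1 * x : ℝ) * Complex.I)

lemma continuous_gaussianWindow : Continuous gaussianWindow := by
  unfold gaussianWindow; fun_prop

/-- The conjugate of the time-frequency shift of the window, as a function of `x`. -/
def shiftedWindow (p : ℝ × ℝ) (x : ℝ) : ℂ :=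
  (gaussianWindow (x - p.2) : ℂ) * Complex.exp (-(2 * Real.pi * p.1 * x : ℝ) * Complex.I)

lemma stft_eq (f : ℝ → ℂ) (p : ℝ × ℝ) : stft f p = ∫ x, f x * shiftedWindow p x := by
  simp only [stft, shiftedWindow, mul_assoc]

lemma continuous_shiftedWindow :
    Continuous (fun q : (ℝ × ℝ) × ℝ => shiftedWindow q.1 q.2) := by
  have h := continuous_gaussianWindow
  unfold shiftedWindow
  fun_prop

lemma norm_shiftedWindow (p : ℝ × ℝ) (x : ℝ) :
    ‖shiftedWindow p x‖ = gaussianWindow (x - p.2) := by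
  have h : 0 ≤ gaussianWindow (x - p.2) := by unfold gaussianWindow; positivity
  rw [shiftedWindow, norm_mul, ← Complex.ofReal_neg, Complex.norm_exp_ofReal_mul_I, mul_one,
    Complex.norm_real, Real.norm_of_nonneg h]

lemma gaussianWindow_sq (x : ℝ) :
    gaussianWindow x ^ 2 = (2 : ℝ) ^ (1 / 2 : ℝ) * Real.exp (-(2 * Real.pi) * x ^ 2) := by
  rw [gaussianWindow, mul_pow, ← Real.exp_nat_mul, ← Real.rpow_natCast, ← Real.rpow_mul (by norm_num)]
  norm_num
  ring_nf

lemma integral_gaussianWindow_sq : ∫ x, gaussianWindow x ^ 2 = 1 := by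
  simp only [gaussianWindow_sq]
  rw [integral_const_mul, integral_gaussian, ← Real.sqrt_eq_rpow, ← Real.sqrt_mul (by norm_num)]
  rw [show 2 * (Real.pi / (2 * Real.pi)) = 1 by field_simp, Real.sqrt_one]

lemma integrable_gaussianWindow_sq : Integrable (fun x => gaussianWindow x ^ 2) := by
  simp only [gaussianWindow_sq]
  exact (integrable_exp_neg_mul_sq (by positivity)).const_mul _

lemma memLp_shiftedWindow (p : ℝ × ℝ) : MemLp (shiftedWindow p) 2 volume := by
  have hc : Continuous (shiftedWindow p) :=
    continuous_shiftedWindow.comp (by fun_prop : Continuous fun x : ℝ => (p, x))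
  rw [memLp_two_iff_integrable_sq_norm hc.aestronglyMeasurable]
  simp only [norm_shiftedWindow]
  exact integrable_gaussianWindow_sq.comp_sub_right p.2

lemma integrable_mul_shiftedWindow (f : Signal) (p : ℝ × ℝ) :
    Integrable (fun x => f x * shiftedWindow p x) :=
  (Lp.memLp f).integrable_mul (memLp_shiftedWindow p)

lemma stft_add (f g : Signal) (p : ℝ × ℝ) :
    stft (f + g : Signal) p = stft f p + stft g p := by
  simp only [stft_eq]
  rw [← integral_add (integrable_mul_shiftedWindow f p) (integrable_mul_shiftedWindow g p)]
  refine integral_congr_ae ?_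
  filter_upwards [Lp.coeFn_add f g] with x hx
  rw [hx, Pi.add_apply, add_mul]

lemma stft_smul (c : ℂ) (f : Signal) (p : ℝ × ℝ) :
    stft (c • f : Signal) p = c * stft f p := by
  simp only [stft_eq]
  rw [← integral_const_mul]
  refine integral_congr_ae ?_
  filter_upwards [Lp.coeFn_smul c f] with x hx
  rw [hx, Pi.smul_apply, smul_eq_mul, mul_assoc]

lemma norm_stft_le (f : Signal) (p : ℝ × ℝ) : ‖stft f p‖ ≤ ‖f‖ := by
  let w : Signal := (memLp_shiftedWindow p).star.toLp _
  have hw : stft f p = inner ℂ w f := by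
    rw [stft_eq, L2.inner_def]
    refine integral_congr_ae ?_
    filter_upwards [(memLp_shiftedWindow p).star.coeFn_toLp] with x hx
    simp only [w, hx, Pi.star_apply, RCLike.inner_apply, RCLike.star_def, Complex.conj_conj]
  have hw1 : ‖w‖ = 1 := by
    have h2 : ‖w‖ ^ 2 = 1 := by
      have h3 : (inner ℂ w w : ℂ) = ((1 : ℝ) : ℂ) := by
        rw [L2.inner_def, ← integral_gaussianWindow_sq,
          ← integral_sub_right_eq_self (fun x => gaussianWindow x ^ 2) p.2, ← integral_complex_ofReal]
        refine integral_congr_ae ?_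
        filter_upwards [(memLp_shiftedWindow p).star.coeFn_toLp] with x hx
        simp only [w, hx, inner_self_eq_norm_sq_to_K, Pi.star_apply, norm_star, norm_shiftedWindow]
        simp
      rw [inner_self_eq_norm_sq_to_K] at h3
      have h4 : ((‖w‖ ^ 2 : ℝ) : ℂ) = ((1 : ℝ) : ℂ) := by
        rw [Complex.ofReal_pow]; exact h3
      exact Complex.ofReal_injective h4
    nlinarith [norm_nonneg w]
  rw [hw]
  calc ‖(inner ℂ w f : ℂ)‖ ≤ ‖w‖ * ‖f‖ := norm_inner_le_norm _ _
    _ = ‖f‖ := by rw [hw1, one_mul]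

lemma stronglyMeasurable_stft (f : Signal) : StronglyMeasurable (stft f) := by
  have h : StronglyMeasurable (fun q : (ℝ × ℝ) × ℝ => f q.2 * shiftedWindow q.1 q.2) :=
    ((Lp.stronglyMeasurable f).comp_measurable measurable_snd).mul
      continuous_shiftedWindow.stronglyMeasurable
  have h2 := h.integral_prod_right' (ν := (volume : Measure ℝ))
  have e : stft f = fun p => ∫ x, f x * shiftedWindow p x := funext (stft_eq f)
  rw [e]
  exact h2

/-- The integrand of the weak definition of the localization operator. -/
def formIntegrand (F : ℝ × ℝ → ℝ) (f g : Signal) (p : ℝ × ℝ) : ℂ :=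
  (F p : ℂ) * ((starRingEnd ℂ) (stft f p) * stft g p)

lemma norm_formIntegrand_le (F : ℝ × ℝ → ℝ) (f g : Signal) (p : ℝ × ℝ) :
    ‖formIntegrand F f g p‖ ≤ ‖F p‖ * (‖f‖ * ‖g‖) := by
  rw [formIntegrand, norm_mul, norm_mul, Complex.norm_real, RCLike.norm_conj]
  gcongr <;> exact norm_stft_le _ _

lemma integrable_formIntegrand {F : ℝ × ℝ → ℝ} (hF : Integrable F) (f g : Signal) :
    Integrable (formIntegrand F f g) := by
  refine (hF.norm.mul_const (‖f‖ * ‖g‖)).mono' ?_ (.of_forall (norm_formIntegrand_le F f g))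
  refine AEStronglyMeasurable.mul
    (Complex.continuous_ofReal.comp_aestronglyMeasurable hF.aestronglyMeasurable) ?_
  exact ((Complex.continuous_conj.comp_stronglyMeasurable (stronglyMeasurable_stft f)).mul
    (stronglyMeasurable_stft g)).aestronglyMeasurable

/-- The bounded sesquilinear form `(f, g) ↦ ∫ F · conj(V f) · V g` on `L²(ℝ)`
for an integrable weight `F`. -/
def localizationForm (F : ℝ × ℝ → ℝ) (hF : Integrable F) : Signal →L⋆[ℂ] Signal →L[ℂ] ℂ :=
  LinearMap.mkContinuous₂
    (LinearMap.mk₂'ₛₗ (starRingEnd ℂ) (RingHom.id ℂ)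
      (fun f g : Signal => ∫ p, formIntegrand F f g p)
      (fun f f' g => by
        rw [← integral_add (integrable_formIntegrand hF _ _) (integrable_formIntegrand hF _ _)]
        congr 1; ext p
        simp only [formIntegrand, stft_add, map_add]; ring)
      (fun c f g => by
        rw [smul_eq_mul, ← integral_const_mul]
        congr 1; ext p
        simp only [formIntegrand, stft_smul, map_mul]; ring)
      (fun f g g' => by
        rw [← integral_add (integrable_formIntegrand hF _ _) (integrable_formIntegrand hF _ _)]
        congr 1; ext p
        simp only [formIntegrand, stft_add]; ring)
      (fun c f g => by
        rw [RingHom.id_apply, smul_eq_mul, ← integral_const_mul]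
        congr 1; ext p
        simp only [formIntegrand, stft_smul]; ring))
    (∫ p, ‖F p‖)
    (fun f g => by
      rw [LinearMap.mk₂'ₛₗ_apply, mul_assoc, ← integral_mul_const]
      exact norm_integral_le_of_norm_le (hF.norm.mul_const _)
        (.of_forall (norm_formIntegrand_le F f g)))

/-- Daubechies' localization operator `P_F` on `L²(ℝ)` with Gaussian window and integrable
weight `F`: the bounded operator given weakly by `⟨P_F f, g⟩ = ⟨F · V f, V g⟩`. -/
def localizationOp (F : ℝ × ℝ → ℝ) (hF : Integrable F) : Signal →L[ℂ] Signal :=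
  InnerProductSpace.continuousLinearMapOfBilin (localizationForm F hF)

/-- The weak definition; `inner ℂ g h` is `⟨h, g⟩` in the convention that is linear
in the first argument. -/
lemma inner_localizationOp (F : ℝ × ℝ → ℝ) (hF : Integrable F) (f g : Signal) :
    inner ℂ g (localizationOp F hF f) =
      ∫ p, (F p : ℂ) * stft f p * (starRingEnd ℂ) (stft g p) := by
  rw [← inner_conj_symm, localizationOp, InnerProductSpace.continuousLinearMapOfBilin_apply,
    localizationForm, LinearMap.mkContinuous₂_apply, LinearMap.mk₂'ₛₗ_apply, ← integral_conj]
  congr 1; ext p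
  simp only [formIntegrand, map_mul, Complex.conj_conj, Complex.conj_ofReal, mul_assoc]

/-- The discrete `n`-iterate Cantor set with base `M` and alphabet `A`. -/
def discreteCantor (n M : ℕ) (A : Finset ℕ) : Set ℕ :=
  {x | ∃ a : Fin n → ℕ, (∀ j, a j ∈ A) ∧ x = ∑ j, a j * M ^ (j : ℕ)}

/-- The `n`-iterate Cantor set based in `[0, L]`,
`L M⁻ⁿ · discreteCantor + [0, L M⁻ⁿ]`. -/
def cantorIterate (n : ℕ) (L : ℝ) (M : ℕ) (A : Finset ℕ) : Set ℝ :=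
  ⋃ x ∈ discreteCantor n M A,
    Set.Icc (L * ((M : ℝ) ^ n)⁻¹ * x) (L * ((M : ℝ) ^ n)⁻¹ * x + L * ((M : ℝ) ^ n)⁻¹)

/-- The spherically symmetric `n`-iterate Cantor set in the disk of radius `R`. -/
def sphericalCantor (n : ℕ) (R : ℝ) (M : ℕ) (A : Finset ℕ) : Set (ℝ × ℝ) :=
  {p | p.1 ^ 2 + p.2 ^ 2 ∈ cantorIterate n (R ^ 2) M A}

lemma finite_discreteCantor (n M : ℕ) (A : Finset ℕ) : (discreteCantor n M A).Finite := by
  have h : (Set.univ.pi fun _ : Fin n => (A : Set ℕ)).Finite :=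
    Set.Finite.pi fun _ => A.finite_toSet
  refine (h.image fun a : Fin n → ℕ => ∑ j, a j * M ^ (j : ℕ)).subset ?_
  rintro x ⟨a, ha, rfl⟩
  exact ⟨a, fun j _ => ha j, rfl⟩

lemma isCompact_cantorIterate (n : ℕ) (L : ℝ) (M : ℕ) (A : Finset ℕ) :
    IsCompact (cantorIterate n L M A) :=
  (finite_discreteCantor n M A).isCompact_biUnion fun _ _ => isCompact_Icc

lemma isCompact_sphericalCantor (n : ℕ) (R : ℝ) (M : ℕ) (A : Finset ℕ) :
    IsCompact (sphericalCantor n R M A) := by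
  have hC := isCompact_cantorIterate n (R ^ 2) M A
  obtain ⟨b, hb⟩ := hC.bddAbove
  refine (isCompact_closedBall (0 : ℝ × ℝ) (1 + |b|)).of_isClosed_subset
    (hC.isClosed.preimage (by fun_prop : Continuous fun p : ℝ × ℝ => p.1 ^ 2 + p.2 ^ 2)) ?_
  intro p hp
  have h : p.1 ^ 2 + p.2 ^ 2 ≤ |b| := (hb hp).trans (le_abs_self b)
  rw [mem_closedBall_zero_iff, Prod.norm_def, sup_le_iff, Real.norm_eq_abs, Real.norm_eq_abs]
  constructor <;> apply abs_le_of_sq_le_sq _ (by positivity) <;>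
    nlinarith [sq_nonneg p.1, sq_nonneg p.2, abs_nonneg b]

lemma integrable_sphericalCantor (n : ℕ) (R : ℝ) (M : ℕ) (A : Finset ℕ) :
    Integrable ((sphericalCantor n R M A).indicator fun _ => (1 : ℝ)) :=
  (integrable_indicator_iff (isCompact_sphericalCantor n R M A).measurableSet).2
    (integrableOn_const (isCompact_sphericalCantor n R M A).measure_lt_top.ne)

/-- Daubechies' localization operator that projects onto the spherically symmetric
`n`-iterate Cantor set of radius `R` with base `M` and alphabet `A`. -/
def cantorLocalizationOp (n : ℕ) (R : ℝ) (M : ℕ) (A : Finset ℕ) : Signal →L[ℂ] Signal :=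
  localizationOp ((sphericalCantor n R M A).indicator fun _ => 1)
    (integrable_sphericalCantor n R M A)

/-- The canonical alphabet `{0, 1, …, m - 1}` of size `m`. -/
def canonicalAlphabet (m : ℕ) : Finset ℕ := Finset.range m

/-- The reverse canonical alphabet `{M - 1, M - 2, …, M - m}` of size `m ≤ M`. -/
def reverseAlphabet (M m : ℕ) : Finset ℕ := Finset.Ico (M - m) M

end Daubechies

end

namespace Daubechies

open Finset

/-! The Hermite functions diagonalize localization to a rotation-invariant set. After removal of a
phase and a Gaussian factor, the STFT with Gaussian window is a power series in `z = t - iω` whose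
coefficients are the Hermite coefficients of the signal (`hasSum_stft`). Monomials in `z` are
orthogonal over every radial set, so the eigenvalues are the masses that the Gamma densities `γ_k(s)
= s^k e^{-s} / k!` give to the one-dimensional Cantor iterate in `[0, L]`, with `L = πR²`. The
operator norm is at most any uniform bound for these masses (`norm_localizationOp_radialSet_le`) and
at least the mass for `k = 0` (`radialEigenvalue_zero_le_norm`).

Upper bound: on each interval of a coarser iterate, a function is at most its mean plus its
variation; summing over the fine intervals gives `setIntegral_cantorIterate_le`. Each `γ_k` has mass
1 and variation at most 2, whatever `k` is. Coarse intervals of length `L / M^j` in `[1, M)` then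
give the order `(m/M)^n L / m^j`, and `m^j` is comparable to `L^(log m / log M)`.

Lower bound for the canonical alphabet: the points whose `j` leading digits vanish give intervals
inside `[0, M]`, where `γ_0 ≥ e^{-M}`.

Reverse alphabet: the leading digit is nonzero, so the set lies in `[L/M, ∞)`, where the variation
of `γ_k` tends to 0 uniformly in `k` (`integral_abs_gammaDensityDeriv_le_tailVariation`). Coarsening
by `q` further levels makes the mean contribute `(m/M)^q` and the variation `m^q` times a quantity
tending to 0. Choosing first `q` and then `n` large makes the ratio of norms small. -/

/-! ### Power series of exponentials of quadratic polynomials -/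

/-- The Taylor coefficients of `z ↦ exp (c z²)`. -/
noncomputable def expSqCoeff (c : ℂ) (j : ℕ) : ℂ :=
  if Even j then c ^ (j / 2) / (j / 2).factorial else 0

lemma norm_expSqCoeff (c : ℂ) (j : ℕ) : (‖expSqCoeff c j‖ : ℂ) = expSqCoeff ‖c‖ j := by
  unfold expSqCoeff
  split_ifs <;> simp

lemma hasSum_expSqCoeff (c z : ℂ) :
    HasSum (fun j => expSqCoeff c j * z ^ j) (Complex.exp (c * z ^ 2)) := by
  have h := NormedSpace.expSeries_div_hasSum_exp (c * z ^ 2)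
  rw [← Complex.exp_eq_exp_ℂ] at h
  have hinj : Function.Injective (fun k : ℕ => 2 * k) := fun a b h => by
    simpa using h
  rw [← hinj.hasSum_iff]
  · refine h.congr_fun fun k => ?_
    simp [expSqCoeff, mul_pow, pow_mul]
    ring
  · intro j hj
    have : ¬ Even j := by
      rintro ⟨k, rfl⟩
      exact hj ⟨k, by simp; ring⟩
    simp [expSqCoeff, this]

lemma summable_norm_expSqCoeff (c z : ℂ) : Summable (fun j => ‖expSqCoeff c j * z ^ j‖) := by
  have h := (hasSum_expSqCoeff ‖c‖ ‖z‖).summable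
  rw [← Complex.summable_ofReal]
  convert h using 2 with j
  simp [norm_expSqCoeff]

/-- The Taylor coefficients of `z ↦ exp (b z + c z²)`. -/
noncomputable def expQuadCoeff (b c : ℂ) (k : ℕ) : ℂ :=
  ∑ p ∈ antidiagonal k, b ^ p.1 / p.1.factorial * expSqCoeff c p.2

lemma expQuadCoeff_eq_coeff (b c : ℂ) (k : ℕ) :
    expQuadCoeff b c k = PowerSeries.coeff k
      (PowerSeries.mk (fun i => b ^ i / (i.factorial : ℂ)) * PowerSeries.mk (expSqCoeff c)) := by
  simp [expQuadCoeff, PowerSeries.coeff_mul]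

lemma deriv_mk_exp (b : ℂ) :
    PowerSeries.derivative ℂ (PowerSeries.mk (fun i => b ^ i / (i.factorial : ℂ))) =
      PowerSeries.C b * PowerSeries.mk (fun i => b ^ i / (i.factorial : ℂ)) := by
  ext k
  rw [PowerSeries.coeff_derivative, PowerSeries.coeff_C_mul,
    PowerSeries.coeff_mk, PowerSeries.coeff_mk, Nat.factorial_succ]
  have := Nat.cast_ne_zero (R := ℂ).2 k.factorial_ne_zero
  have h2 : (k : ℂ) + 1 ≠ 0 := by exact_mod_cast k.succ_ne_zero
  push_cast
  field_simp
  ring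

lemma deriv_mk_expSqCoeff (c : ℂ) :
    PowerSeries.derivative ℂ (PowerSeries.mk (expSqCoeff c)) =
      PowerSeries.C (2 * c) * (PowerSeries.X * PowerSeries.mk (expSqCoeff c)) := by
  ext k
  rw [PowerSeries.coeff_derivative, PowerSeries.coeff_C_mul,
    PowerSeries.coeff_mk]
  rcases k with _ | k
  · simp [expSqCoeff]
  · rw [PowerSeries.coeff_succ_X_mul, PowerSeries.coeff_mk]
    unfold expSqCoeff
    by_cases hk : Even k
    · obtain ⟨l, rfl⟩ := hk
      have h1 : (l + l + 1 + 1) / 2 = l + 1 := by omega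
      have h2 : (l + l) / 2 = l := by omega
      have h3 : Even (l + l + 1 + 1) := ⟨l + 1, by ring⟩
      rw [if_pos h3, if_pos ⟨l, rfl⟩, h1, h2, Nat.factorial_succ]
      have := Nat.cast_ne_zero (R := ℂ).2 l.factorial_ne_zero
      have h2 : (l : ℂ) + 1 ≠ 0 := by exact_mod_cast l.succ_ne_zero
      push_cast
      field_simp
      ring
    · have : ¬ Even (k + 1 + 1) := by
        simpa [Nat.even_add_one] using hk
      simp [hk, this]

lemma expQuadCoeff_zero (b c : ℂ) : expQuadCoeff b c 0 = 1 := by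
  simp [expQuadCoeff, expSqCoeff]

/-- The differential equation `F' = (b + 2cz) F` of `F = exp (bz + cz²)`, as formal power series;
its coefficients give the three-term recurrence. -/
lemma deriv_expQuad (b c : ℂ) (k : ℕ) :
    PowerSeries.coeff k (PowerSeries.derivative ℂ
      (PowerSeries.mk (fun i => b ^ i / (i.factorial : ℂ)) * PowerSeries.mk (expSqCoeff c))) =
    PowerSeries.coeff k (PowerSeries.C b * (PowerSeries.mk (fun i => b ^ i / (i.factorial : ℂ)) *
      PowerSeries.mk (expSqCoeff c)) + PowerSeries.C (2 * c) * (PowerSeries.X *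
      (PowerSeries.mk (fun i => b ^ i / (i.factorial : ℂ)) * PowerSeries.mk (expSqCoeff c)))) := by
  rw [Derivation.leibniz, deriv_mk_exp, deriv_mk_expSqCoeff, smul_eq_mul, smul_eq_mul]
  congr 1
  ring

lemma expQuadCoeff_one (b c : ℂ) : expQuadCoeff b c 1 = b := by
  have h := deriv_expQuad b c 0
  rw [PowerSeries.coeff_derivative, map_add,
    PowerSeries.coeff_C_mul, PowerSeries.coeff_C_mul, PowerSeries.coeff_zero_X_mul,
    ← expQuadCoeff_eq_coeff, ← expQuadCoeff_eq_coeff, expQuadCoeff_zero] at h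
  simpa using h

lemma expQuadCoeff_add_two (b c : ℂ) (k : ℕ) :
    ((k : ℂ) + 2) * expQuadCoeff b c (k + 2) =
      b * expQuadCoeff b c (k + 1) + 2 * c * expQuadCoeff b c k := by
  have h := deriv_expQuad b c (k + 1)
  rw [PowerSeries.coeff_derivative, map_add,
    PowerSeries.coeff_C_mul, PowerSeries.coeff_C_mul, PowerSeries.coeff_succ_X_mul,
    ← expQuadCoeff_eq_coeff, ← expQuadCoeff_eq_coeff, ← expQuadCoeff_eq_coeff] at h
  rw [← h]
  push_cast
  ring

lemma hasSum_expQuadCoeff (b c z : ℂ) :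
    HasSum (fun k => expQuadCoeff b c k * z ^ k) (Complex.exp (b * z + c * z ^ 2)) := by
  have hf := NormedSpace.expSeries_div_hasSum_exp (b * z)
  rw [← Complex.exp_eq_exp_ℂ] at hf
  have hf' := NormedSpace.norm_expSeries_div_summable (b * z)
  have hg := hasSum_expSqCoeff c z
  have hg' := summable_norm_expSqCoeff c z
  have h1 := tsum_mul_tsum_eq_tsum_sum_antidiagonal_of_summable_norm hf' hg'
  have h2 := (summable_norm_sum_mul_antidiagonal_of_summable_norm hf' hg').of_norm.hasSum
  rw [← h1, hf.tsum_eq, hg.tsum_eq, ← Complex.exp_add] at h2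
  refine h2.congr_fun fun k => ?_
  rw [expQuadCoeff, sum_mul]
  refine sum_congr rfl fun p hp => ?_
  rw [← mem_antidiagonal.1 hp]
  ring

/-- Coefficientwise majorant by the triangle inequality. The first conjunct says that the majorant
is real, so its real part loses nothing. -/
lemma norm_expQuadCoeff_le (b c : ℂ) (k : ℕ) :
    ((expQuadCoeff ‖b‖ ‖c‖ k).re : ℂ) = expQuadCoeff ‖b‖ ‖c‖ k ∧
    ‖expQuadCoeff b c k‖ ≤ (expQuadCoeff ‖b‖ ‖c‖ k).re := by
  have h : expQuadCoeff ‖b‖ ‖c‖ k = ((∑ p ∈ antidiagonal k,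
      ‖b ^ p.1 / p.1.factorial * expSqCoeff c p.2‖ : ℝ) : ℂ) := by
    rw [expQuadCoeff, Complex.ofReal_sum]
    refine sum_congr rfl fun p _ => ?_
    simp [norm_expSqCoeff]
  rw [h, Complex.ofReal_re]
  exact ⟨rfl, norm_sum_le _ _⟩

/-! ### Hermite polynomials and their generating function -/

/-- The Hermite polynomials in the normalization with generating function
`∑ Qₖ(x) zᵏ = exp (2π x z - π z² / 2)`. -/
noncomputable def hermitePoly : ℕ → Polynomial ℝ
  | 0 => 1
  | 1 => Polynomial.C (2 * Real.pi) * Polynomial.X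
  | k + 2 => Polynomial.C ((k : ℝ) + 2)⁻¹ *
      (Polynomial.C (2 * Real.pi) * Polynomial.X * hermitePoly (k + 1) -
        Polynomial.C Real.pi * hermitePoly k)

lemma hermitePoly_add_two (k : ℕ) (x : ℝ) :
    ((k : ℝ) + 2) * (hermitePoly (k + 2)).eval x =
      2 * Real.pi * x * (hermitePoly (k + 1)).eval x - Real.pi * (hermitePoly k).eval x := by
  have : (k : ℝ) + 2 ≠ 0 := by positivity
  rw [hermitePoly]
  simp only [Polynomial.eval_mul, Polynomial.eval_sub, Polynomial.eval_C, Polynomial.eval_X]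
  field_simp

lemma derivative_hermitePoly_succ (k : ℕ) :
    Polynomial.derivative (hermitePoly (k + 1)) =
      Polynomial.C (2 * Real.pi) * hermitePoly k := by
  induction k using Nat.twoStepInduction with
  | zero => simp [hermitePoly]
  | one =>
    simp [hermitePoly]
    apply Polynomial.funext
    intro x
    simp
    ring
  | more k h1 h2 =>
    apply Polynomial.funext
    intro x
    have e := hermitePoly_add_two k x
    rw [hermitePoly]
    simp only [Polynomial.derivative_mul, Polynomial.derivative_C, zero_mul, zero_add,
      Polynomial.derivative_sub, h1, h2, Polynomial.derivative_X, mul_one, Polynomial.eval_mul,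
      Polynomial.eval_sub, Polynomial.eval_add, Polynomial.eval_C, Polynomial.eval_X]
    rw [show k + 1 + 1 = k + 2 from rfl]
    have : ((k + 1 : ℕ) : ℝ) + 2 ≠ 0 := by positivity
    field_simp
    push_cast
    linear_combination (-1 : ℝ) * e

/-- Both sides have the same first two terms and obey the same recurrence. -/
lemma hermitePoly_eval_eq (k : ℕ) (x : ℝ) :
    (((hermitePoly k).eval x : ℝ) : ℂ) =
      expQuadCoeff ((2 * Real.pi * x : ℝ) : ℂ) ((-(Real.pi / 2) : ℝ) : ℂ) k := by
  induction k using Nat.twoStepInduction with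
  | zero => simp [hermitePoly, expQuadCoeff_zero]
  | one => simp [hermitePoly, expQuadCoeff_one]
  | more k h1 h2 =>
    have h := expQuadCoeff_add_two ((2 * Real.pi * x : ℝ) : ℂ) ((-(Real.pi / 2) : ℝ) : ℂ) k
    have e := congrArg (fun y : ℝ => (y : ℂ)) (hermitePoly_add_two k x)
    have : (k : ℂ) + 2 ≠ 0 := by exact_mod_cast (k + 1).succ_ne_zero
    apply mul_left_cancel₀ this
    rw [h, ← h1, ← h2]
    push_cast at e ⊢
    rw [e]
    ring

lemma hasSum_hermitePoly (x : ℝ) (z : ℂ) :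
    HasSum (fun k => (((hermitePoly k).eval x : ℝ) : ℂ) * z ^ k)
      (Complex.exp (2 * Real.pi * x * z - Real.pi / 2 * z ^ 2)) := by
  simp only [hermitePoly_eval_eq]
  convert hasSum_expQuadCoeff _ _ z using 2
  push_cast
  ring

/-- The majorant of `Qₖ(x) zᵏ`, `r = ‖z‖`. -/
noncomputable def hermiteBound (r x : ℝ) (k : ℕ) : ℝ :=
  (expQuadCoeff ((2 * Real.pi * |x| : ℝ) : ℂ) ((Real.pi / 2 : ℝ) : ℂ) k).re * r ^ k

lemma norm_hermitePoly_mul_le (x : ℝ) (z : ℂ) (k : ℕ) :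
    ‖(((hermitePoly k).eval x : ℝ) : ℂ) * z ^ k‖ ≤ hermiteBound ‖z‖ x k := by
  rw [norm_mul, norm_pow, hermiteBound, hermitePoly_eval_eq]
  gcongr
  have h := (norm_expQuadCoeff_le ((2 * Real.pi * x : ℝ) : ℂ) ((-(Real.pi / 2) : ℝ) : ℂ) k).2
  rw [Complex.norm_real, Complex.norm_real, norm_neg, Real.norm_eq_abs, abs_mul,
    Real.norm_of_nonneg (by positivity : 0 ≤ Real.pi / 2),
    abs_of_nonneg (by positivity : 0 ≤ 2 * Real.pi)] at h
  exact h

lemma hasSum_hermiteBound (r x : ℝ) :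
    HasSum (hermiteBound r x) (Real.exp (2 * Real.pi * |x| * r + Real.pi / 2 * r ^ 2)) := by
  rw [← Complex.hasSum_ofReal]
  convert hasSum_expQuadCoeff ((2 * Real.pi * |x| : ℝ) : ℂ) ((Real.pi / 2 : ℝ) : ℂ) r using 2
    with k
  · have h := (norm_expQuadCoeff_le ((2 * Real.pi * |x| : ℝ) : ℂ) ((Real.pi / 2 : ℝ) : ℂ) k).1
    rw [Complex.norm_real, Complex.norm_real, Real.norm_of_nonneg (by positivity),
      Real.norm_of_nonneg (by positivity)] at h
    rw [hermiteBound, Complex.ofReal_mul, h, Complex.ofReal_pow]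
  · push_cast
    rfl

/-! ### Gaussian moments and orthogonality of the Hermite functions -/

lemma integrable_polynomial_mul_gaussianWindow_sq (p : Polynomial ℝ) :
    Integrable (fun x => p.eval x * gaussianWindow x ^ 2) := by
  induction p using Polynomial.induction_on' with
  | add p q hp hq =>
    refine (hp.add hq).congr (.of_forall fun x => ?_)
    simp [add_mul]
  | monomial n a =>
    have h := integrable_rpow_mul_exp_neg_mul_sq (b := 2 * Real.pi) (by positivity) (s := n)
      (by linarith [n.cast_nonneg (α := ℝ)])
    refine (h.const_mul (a * 2 ^ (1 / 2 : ℝ))).congr (.of_forall fun x => ?_)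
    simp only [Polynomial.eval_monomial, gaussianWindow_sq, Real.rpow_natCast]
    ring

lemma hasDerivAt_gaussianWindow_sq (x : ℝ) :
    HasDerivAt (fun x => gaussianWindow x ^ 2) (-(4 * Real.pi) * x * gaussianWindow x ^ 2) x := by
  simp only [gaussianWindow_sq]
  have h := (((hasDerivAt_pow 2 x).const_mul (-(2 * Real.pi))).exp).const_mul
    ((2 : ℝ) ^ (1 / 2 : ℝ))
  refine h.congr_deriv ?_
  push_cast
  ring

/-- The integral of a polynomial against the squared Gaussian window. -/
noncomputable def gaussianMoment (p : Polynomial ℝ) : ℝ := ∫ x, p.eval x * gaussianWindow x ^ 2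

lemma gaussianMoment_add (p q : Polynomial ℝ) :
    gaussianMoment (p + q) = gaussianMoment p + gaussianMoment q := by
  unfold gaussianMoment
  rw [← integral_add (integrable_polynomial_mul_gaussianWindow_sq p)
    (integrable_polynomial_mul_gaussianWindow_sq q)]
  simp [add_mul]

lemma gaussianMoment_C_mul (c : ℝ) (p : Polynomial ℝ) :
    gaussianMoment (Polynomial.C c * p) = c * gaussianMoment p := by
  unfold gaussianMoment
  rw [← integral_const_mul]
  simp [mul_assoc]

/-- Integration by parts, the logarithmic derivative of the weight being `-4πx`. -/
lemma gaussianMoment_derivative (p : Polynomial ℝ) :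
    gaussianMoment (Polynomial.derivative p) =
      4 * Real.pi * gaussianMoment (Polynomial.X * p) := by
  have h := integral_eq_zero_of_hasDerivAt_of_integrable
    (f := fun x => p.eval x * gaussianWindow x ^ 2)
    (f' := fun x => (Polynomial.derivative p + Polynomial.C (-(4 * Real.pi)) *
      (Polynomial.X * p)).eval x * gaussianWindow x ^ 2)
    (fun x => by
      refine ((p.hasDerivAt x).mul (hasDerivAt_gaussianWindow_sq x)).congr_deriv ?_
      simp only [Polynomial.eval_add, Polynomial.eval_mul, Polynomial.eval_C, Polynomial.eval_X]
      ring)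
    (integrable_polynomial_mul_gaussianWindow_sq _) (integrable_polynomial_mul_gaussianWindow_sq p)
  change gaussianMoment _ = 0 at h
  rw [gaussianMoment_add, gaussianMoment_C_mul] at h
  linarith

lemma succ_mul_hermitePoly_succ (k : ℕ) :
    Polynomial.C ((k : ℝ) + 1) * hermitePoly (k + 1) =
      Polynomial.C (2 * Real.pi) * (Polynomial.X * hermitePoly k) +
        Polynomial.C (-(1 / 2)) * Polynomial.derivative (hermitePoly k) := by
  apply Polynomial.funext
  intro x
  rcases k with _ | k
  · simp [hermitePoly]
  · have h := hermitePoly_add_two k x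
    rw [derivative_hermitePoly_succ]
    simp only [Polynomial.eval_add, Polynomial.eval_mul, Polynomial.eval_C, Polynomial.eval_X]
    push_cast
    linear_combination h

/-- The raising operator `2πx - (1/2) d/dx` is half the adjoint of `d/dx` for the Gaussian weight,
so lowering the index puts a derivative on `q`. -/
lemma gaussianMoment_hermitePoly_succ (k : ℕ) (q : Polynomial ℝ) :
    ((k : ℝ) + 1) * gaussianMoment (hermitePoly (k + 1) * q) =
      1 / 2 * gaussianMoment (hermitePoly k * Polynomial.derivative q) := by
  have h := gaussianMoment_derivative (hermitePoly k * q)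
  rw [Polynomial.derivative_mul, gaussianMoment_add] at h
  rw [← gaussianMoment_C_mul, ← mul_assoc, succ_mul_hermitePoly_succ, add_mul,
    gaussianMoment_add, mul_assoc, mul_assoc, mul_assoc, gaussianMoment_C_mul,
    gaussianMoment_C_mul]
  linear_combination (-1 / 2 : ℝ) * h

/-- Each adjunction step lowers both indices by one, since the derivative of a Hermite polynomial is
a multiple of the preceding one. -/
lemma gaussianMoment_hermitePoly_mul (k l : ℕ) :
    gaussianMoment (hermitePoly k * hermitePoly l) =
      if k = l then Real.pi ^ k / k.factorial else 0 := by
  induction k generalizing l with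
  | zero =>
    rcases l with _ | l
    · simp [gaussianMoment, hermitePoly, integral_gaussianWindow_sq]
    · have h := gaussianMoment_hermitePoly_succ l 1
      simp only [Polynomial.derivative_one, mul_zero, mul_one] at h
      have h0 : gaussianMoment 0 = 0 := by simp [gaussianMoment]
      rw [h0, mul_zero] at h
      have : (l : ℝ) + 1 ≠ 0 := by positivity
      simpa [hermitePoly, this] using h
  | succ k ih =>
    have hk : (k : ℝ) + 1 ≠ 0 := by positivity
    apply mul_left_cancel₀ hk
    rw [gaussianMoment_hermitePoly_succ]
    rcases l with _ | l
    · simp [hermitePoly, gaussianMoment]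
    · rw [derivative_hermitePoly_succ, mul_left_comm, gaussianMoment_C_mul, ih]
      by_cases h : k = l
      · subst h
        simp only [if_true, Nat.factorial_succ]
        have := Nat.cast_ne_zero (R := ℝ).2 k.factorial_ne_zero
        push_cast
        field_simp
        ring
      · simp [h]

/-- The (unnormalized) Hermite functions. -/
noncomputable def hermiteFun (k : ℕ) (x : ℝ) : ℂ :=
  (((hermitePoly k).eval x * gaussianWindow x : ℝ) : ℂ)

lemma continuous_hermiteFun (k : ℕ) : Continuous (hermiteFun k) := by
  unfold hermiteFun
  have := continuous_gaussianWindow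
  fun_prop

lemma memLp_hermiteFun (k : ℕ) : MemLp (hermiteFun k) 2 volume := by
  rw [memLp_two_iff_integrable_sq_norm (continuous_hermiteFun k).aestronglyMeasurable]
  refine (integrable_polynomial_mul_gaussianWindow_sq (hermitePoly k * hermitePoly k)).congr
    (.of_forall fun x => ?_)
  simp only [hermiteFun, Complex.norm_real, Real.norm_eq_abs, sq_abs, Polynomial.eval_mul]
  ring

/-- The Hermite functions as elements of `L²`. -/
noncomputable def hermiteSignal (k : ℕ) : Signal := (memLp_hermiteFun k).toLp _

/-- The (unnormalized) Hermite coefficients of a signal. -/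
noncomputable def hermiteCoeff (f : ℝ → ℂ) (k : ℕ) : ℂ := ∫ x, f x * hermiteFun k x

lemma inner_hermiteSignal (k : ℕ) (f : Signal) :
    inner ℂ (hermiteSignal k) f = hermiteCoeff f k := by
  rw [L2.inner_def, hermiteCoeff]
  refine integral_congr_ae ?_
  filter_upwards [(memLp_hermiteFun k).coeFn_toLp] with x hx
  simp only [hermiteSignal, hx, RCLike.inner_apply, hermiteFun, Complex.conj_ofReal]

lemma hermiteCoeff_hermiteSignal (k l : ℕ) :
    hermiteCoeff (hermiteSignal l) k =
      if k = l then ((Real.pi ^ k / k.factorial : ℝ) : ℂ) else 0 := by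
  have h : hermiteCoeff (hermiteSignal l) k =
      ((gaussianMoment (hermitePoly k * hermitePoly l) : ℝ) : ℂ) := by
    rw [hermiteCoeff, gaussianMoment, ← integral_complex_ofReal]
    refine integral_congr_ae ?_
    filter_upwards [(memLp_hermiteFun l).coeFn_toLp] with x hx
    simp only [hermiteSignal, hx, hermiteFun, Polynomial.eval_mul]
    push_cast
    ring
  rw [h, gaussianMoment_hermitePoly_mul]
  split_ifs <;> simp

/-- Bessel's inequality for the Hermite functions. -/
lemma sum_hermiteCoeff_sq_le (f : Signal) (N : ℕ) :
    ∑ k ∈ range N, k.factorial / Real.pi ^ k * ‖hermiteCoeff f k‖ ^ 2 ≤ ‖f‖ ^ 2 := by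
  have ho : Orthonormal ℂ (fun k : ℕ =>
      ((√(k.factorial / Real.pi ^ k) : ℝ) : ℂ) • hermiteSignal k) := by
    rw [orthonormal_iff_ite]
    intro k l
    rw [inner_smul_left, inner_smul_right, inner_hermiteSignal, hermiteCoeff_hermiteSignal]
    split_ifs with h
    · subst h
      rw [Complex.conj_ofReal, ← mul_assoc, ← Complex.ofReal_mul, Real.mul_self_sqrt (by positivity),
        ← Complex.ofReal_mul]
      have := Nat.cast_ne_zero (R := ℝ).2 k.factorial_ne_zero
      have h1 : (k.factorial / Real.pi ^ k) * (Real.pi ^ k / k.factorial) = 1 := by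
        field_simp
      rw [h1, Complex.ofReal_one]
    · simp
  refine le_of_eq_of_le (sum_congr rfl fun k _ => ?_) (ho.sum_inner_products_le (s := range N) f)
  rw [inner_smul_left, inner_hermiteSignal, norm_mul, Complex.conj_ofReal, Complex.norm_real,
    Real.norm_of_nonneg (by positivity), mul_pow, Real.sq_sqrt (by positivity)]

lemma norm_hermiteSignal_zero : ‖hermiteSignal 0‖ = 1 := by
  have h : (inner ℂ (hermiteSignal 0) (hermiteSignal 0) : ℂ) = 1 := by
    rw [inner_hermiteSignal, hermiteCoeff_hermiteSignal]
    simp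
  rw [inner_self_eq_norm_sq_to_K] at h
  have h4 : ((‖hermiteSignal 0‖ ^ 2 : ℝ) : ℂ) = ((1 : ℝ) : ℂ) := by
    rw [Complex.ofReal_pow, Complex.ofReal_one]; exact h
  have := Complex.ofReal_injective h4
  nlinarith [norm_nonneg (hermiteSignal 0)]

/-! ### The STFT as a power series in the Bargmann variable -/

/-- The Bargmann variable of a point `(ω, t)` of the time-frequency plane. -/
noncomputable def bargmannVar (p : ℝ × ℝ) : ℂ := p.2 - p.1 * Complex.I

lemma continuous_bargmannVar : Continuous bargmannVar := by
  unfold bargmannVar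
  fun_prop

/-- Completing the square makes the time-frequency shift holomorphic in the Bargmann variable: the
right side is the window times the Hermite generating function. -/
lemma exp_phase_mul_shiftedWindow (p : ℝ × ℝ) (x : ℝ) :
    Complex.exp (Real.pi / 2 * (p.1 ^ 2 + p.2 ^ 2) + Real.pi * p.1 * p.2 * Complex.I) *
      shiftedWindow p x = gaussianWindow x *
        Complex.exp (2 * Real.pi * x * bargmannVar p - Real.pi / 2 * bargmannVar p ^ 2) := by
  unfold shiftedWindow gaussianWindow bargmannVar
  push_cast
  have e : ∀ a b c d : ℂ, Complex.exp a * (d * Complex.exp b * Complex.exp c) =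
      d * Complex.exp (a + b + c) := fun a b c d => by
    rw [Complex.exp_add, Complex.exp_add]; ring
  rw [e, mul_assoc (_ : ℂ) (Complex.exp _) (Complex.exp _), ← Complex.exp_add]
  congr 2
  linear_combination (Real.pi / 2 * p.1 ^ 2) * Complex.I_sq

lemma integrable_mul_gaussianWindow_mul_exp (f : Signal) (r : ℝ) (c : ℝ) :
    Integrable (fun x => ‖f x‖ * gaussianWindow x *
      Real.exp (2 * Real.pi * |x| * r + c)) := by
  have hg : MemLp (fun x => gaussianWindow x * Real.exp (2 * Real.pi * |x| * r + c)) 2 volume := by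
    have hc : Continuous (fun x => gaussianWindow x * Real.exp (2 * Real.pi * |x| * r + c)) := by
      have := continuous_gaussianWindow
      fun_prop
    rw [memLp_two_iff_integrable_sq_norm hc.aestronglyMeasurable]
    -- The constant comes from `π (|x| - 2r)² ≥ 0`, which absorbs `4π|x|r` into half of the Gaussian
    -- exponent.
    have hi := (integrable_exp_neg_mul_sq (b := Real.pi) Real.pi_pos).const_mul
      ((2 : ℝ) ^ (1 / 2 : ℝ) * Real.exp (4 * Real.pi * r ^ 2 + 2 * c))
    refine hi.mono' (hc.norm.pow 2).aestronglyMeasurable (.of_forall fun x => ?_)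
    rw [Real.norm_of_nonneg (by positivity), norm_mul, mul_pow, Real.norm_eq_abs, sq_abs,
      gaussianWindow_sq, Real.norm_of_nonneg (Real.exp_pos _).le,
      mul_assoc (_ : ℝ) (Real.exp _) (_ : ℝ), mul_assoc (_ : ℝ) (Real.exp _) (_ : ℝ),
      ← Real.exp_nat_mul, ← Real.exp_add, ← Real.exp_add]
    refine mul_le_mul_of_nonneg_left (Real.exp_le_exp.2 ?_) (by positivity)
    push_cast
    nlinarith [Real.pi_pos, mul_nonneg Real.pi_pos.le (sq_nonneg (|x| - 2 * r)), sq_abs x]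
  have h := (Lp.memLp f).norm.integrable_mul hg
  refine h.congr (.of_forall fun x => ?_)
  simp only [Pi.mul_apply]
  ring

/-- The generating function integrated term by term against `f` times the window; `hermiteBound`
provides the dominating series. -/
lemma hasSum_stft (f : Signal) (p : ℝ × ℝ) :
    HasSum (fun k => hermiteCoeff f k * bargmannVar p ^ k)
      (Complex.exp (Real.pi / 2 * (p.1 ^ 2 + p.2 ^ 2) + Real.pi * p.1 * p.2 * Complex.I) *
        stft f p) := by
  have hpos : ∀ x, 0 ≤ gaussianWindow x := fun x => by unfold gaussianWindow; positivity
  rw [stft_eq, ← integral_const_mul]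
  simp only [hermiteCoeff, ← integral_mul_const]
  refine hasSum_integral_of_dominated_convergence
    (fun k x => ‖f x‖ * gaussianWindow x * hermiteBound ‖bargmannVar p‖ x k) ?_ ?_ ?_ ?_ ?_
  · intro k
    exact ((Lp.aestronglyMeasurable f).mul
      (continuous_hermiteFun k).aestronglyMeasurable).mul_const _
  · refine fun k => .of_forall fun x => ?_
    have h := norm_hermitePoly_mul_le x (bargmannVar p) k
    have e : f x * hermiteFun k x * bargmannVar p ^ k = f x * (gaussianWindow x : ℂ) *
        ((((hermitePoly k).eval x : ℝ) : ℂ) * bargmannVar p ^ k) := by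
      rw [hermiteFun]; push_cast; ring
    rw [e, norm_mul, norm_mul, Complex.norm_real, Real.norm_of_nonneg (hpos x)]
    exact mul_le_mul_of_nonneg_left h (mul_nonneg (norm_nonneg _) (hpos x))
  · exact .of_forall fun x => (hasSum_hermiteBound _ x).summable.mul_left _
  · simp only [tsum_mul_left, (hasSum_hermiteBound _ _).tsum_eq]
    exact integrable_mul_gaussianWindow_mul_exp f _ _
  · refine .of_forall fun x => ?_
    have h := (hasSum_hermitePoly x (bargmannVar p)).mul_left (f x * (gaussianWindow x : ℂ))
    rw [mul_left_comm, exp_phase_mul_shiftedWindow, ← mul_assoc]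
    refine h.congr_fun fun k => ?_
    rw [hermiteFun]; push_cast; ring

lemma norm_stft_sq (f : Signal) (p : ℝ × ℝ) :
    ‖stft f p‖ ^ 2 = Real.exp (-Real.pi * (p.1 ^ 2 + p.2 ^ 2)) *
      ‖∑' k, hermiteCoeff f k * bargmannVar p ^ k‖ ^ 2 := by
  rw [(hasSum_stft f p).tsum_eq, norm_mul, Complex.norm_exp, mul_pow, ← Real.exp_nat_mul,
    ← mul_assoc, ← Real.exp_add]
  have : -Real.pi * (p.1 ^ 2 + p.2 ^ 2) + ((2 : ℕ) : ℝ) * (Real.pi / 2 * (p.1 ^ 2 + p.2 ^ 2) +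
      Real.pi * p.1 * p.2 * Complex.I : ℂ).re = 0 := by
    have e : (Real.pi / 2 * (p.1 ^ 2 + p.2 ^ 2) + Real.pi * p.1 * p.2 * Complex.I : ℂ) =
      ((Real.pi / 2 * (p.1 ^ 2 + p.2 ^ 2) : ℝ) : ℂ) + ((Real.pi * p.1 * p.2 : ℝ) : ℂ) * Complex.I := by
      push_cast; ring
    rw [e, Complex.add_re, Complex.ofReal_re, Complex.re_ofReal_mul, Complex.I_re]
    push_cast
    ring
  rw [this, Real.exp_zero, one_mul]

/-! ### Radial sets: eigenvalues and operator norm -/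

/-- The density of the Gamma distribution with shape `k + 1` and rate `1`. -/
noncomputable def gammaDensity (k : ℕ) (s : ℝ) : ℝ := s ^ k / k.factorial * Real.exp (-s)

/-- The eigenvalues of the localization operator for the radial set `{ω² + t² ∈ C}`. -/
noncomputable def radialEigenvalue (C : Set ℝ) (k : ℕ) : ℝ :=
  ∫ s in Set.Ioi 0 ∩ (fun s => s / Real.pi) ⁻¹' C, gammaDensity k s

/-- The spherically symmetric subset of the plane with squared radii in `C`. -/
def radialSet (C : Set ℝ) : Set (ℝ × ℝ) := {p | p.1 ^ 2 + p.2 ^ 2 ∈ C}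

lemma measurableSet_radialSet {C : Set ℝ} (hC : MeasurableSet C) :
    MeasurableSet (radialSet C) :=
  (by fun_prop : Measurable fun p : ℝ × ℝ => p.1 ^ 2 + p.2 ^ 2) hC

lemma integral_unit_pow (k l : ℕ) :
    ∫ θ in Set.Ioo (-Real.pi) Real.pi, (bargmannVar (Real.cos θ, Real.sin θ)) ^ k *
      (starRingEnd ℂ (bargmannVar (Real.cos θ, Real.sin θ))) ^ l =
    if k = l then 2 * (Real.pi : ℂ) else 0 := by
  -- The first coordinate is the frequency, so the variable is `sin θ - i cos θ`, a rotated
  -- `e^{iθ}`.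
  have hu : ∀ θ : ℝ, bargmannVar (Real.cos θ, Real.sin θ) =
      -Complex.I * Complex.exp (θ * Complex.I) := fun θ => by
    rw [Complex.exp_mul_I, bargmannVar, Complex.ofReal_cos, Complex.ofReal_sin]
    linear_combination Complex.sin θ * Complex.I_sq
  have hv : ∀ θ : ℝ, starRingEnd ℂ (bargmannVar (Real.cos θ, Real.sin θ)) =
      Complex.I * Complex.exp (-(θ * Complex.I)) := fun θ => by
    rw [hu, map_mul, ← Complex.exp_conj]
    simp
  have he : ∀ θ : ℝ, (bargmannVar (Real.cos θ, Real.sin θ)) ^ k *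
      (starRingEnd ℂ (bargmannVar (Real.cos θ, Real.sin θ))) ^ l =
      (-Complex.I) ^ k * Complex.I ^ l *
        Complex.exp ((((k : ℂ) - l) * Complex.I) * θ) := fun θ => by
    rw [hv, hu, mul_pow, mul_pow, ← Complex.exp_nat_mul, ← Complex.exp_nat_mul,
      mul_mul_mul_comm, ← Complex.exp_add]
    congr 2
    ring
  simp only [he]
  rw [integral_const_mul, ← integral_Ioc_eq_integral_Ioo,
    ← intervalIntegral.integral_of_le (by linarith [Real.pi_pos])]
  split_ifs with h
  · subst h
    rw [← mul_pow]
    simp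
    ring
  · have hc : ((k : ℂ) - l) * Complex.I ≠ 0 :=
      mul_ne_zero (sub_ne_zero.2 (by exact_mod_cast h)) Complex.I_ne_zero
    rw [integral_exp_mul_complex hc]
    have : Complex.exp (((k : ℂ) - l) * Complex.I * (Real.pi : ℝ)) =
        Complex.exp (((k : ℂ) - l) * Complex.I * ((-Real.pi : ℝ) : ℂ)) := by
      rw [Complex.exp_eq_exp_iff_exists_int]
      exact ⟨k - l, by push_cast; ring⟩
    rw [this, sub_self, zero_div, mul_zero]

/-- Substitution `s = πr²`. -/
lemma integral_radial {C : Set ℝ} (hC : MeasurableSet C) (k : ℕ) :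
    ∫ r in Set.Ioi (0 : ℝ), C.indicator (fun _ => (1 : ℝ)) (r ^ 2) *
      (r ^ (2 * k + 1) * Real.exp (-Real.pi * r ^ 2)) =
    k.factorial / Real.pi ^ k / (2 * Real.pi) * radialEigenvalue C k := by
  have hpi := Real.pi_pos
  let g : ℝ → ℝ := ((fun s => s / Real.pi) ⁻¹' C).indicator (gammaDensity k)
  have h0 : radialEigenvalue C k = ∫ s in Set.Ioi 0, g s := by
    rw [radialEigenvalue, setIntegral_indicator (hC.preimage (by fun_prop))]
  have h1 := integral_comp_mul_left_Ioi g 0 hpi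
  have h2 := integral_comp_rpow_Ioi_of_pos (g := fun y => g (Real.pi * y)) (p := 2) (by norm_num)
  rw [mul_zero, smul_eq_mul, ← h0] at h1
  rw [h1] at h2
  have h3 : radialEigenvalue C k = Real.pi * (Real.pi⁻¹ * radialEigenvalue C k) := by
    field_simp
  rw [h3, ← h2, ← integral_const_mul, ← integral_const_mul]
  refine setIntegral_congr_fun measurableSet_Ioi fun r hr => ?_
  have hr' : (0 : ℝ) < r := hr
  have e1 : r ^ (2 - 1 : ℝ) = r := by norm_num
  have e2 : r ^ (2 : ℝ) = r ^ 2 := by exact_mod_cast Real.rpow_natCast r 2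
  simp only [e1, e2, g, smul_eq_mul]
  have := Nat.cast_ne_zero (R := ℝ).2 k.factorial_ne_zero
  by_cases hrC : r ^ 2 ∈ C
  · rw [Set.indicator_of_mem hrC, Set.indicator_of_mem (by
      rw [Set.mem_preimage, mul_div_cancel_left₀ _ hpi.ne']; exact hrC), gammaDensity]
    field_simp
    ring
  · rw [Set.indicator_of_notMem hrC, Set.indicator_of_notMem (by
      rw [Set.mem_preimage, mul_div_cancel_left₀ _ hpi.ne']; exact hrC)]
    simp

lemma setIntegral_radialSet_pow {C : Set ℝ} (hC : MeasurableSet C) (k l : ℕ) :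
    ∫ p in radialSet C, bargmannVar p ^ k * (starRingEnd ℂ (bargmannVar p)) ^ l *
      ((Real.exp (-Real.pi * (p.1 ^ 2 + p.2 ^ 2)) : ℝ) : ℂ) =
    if k = l then ((k.factorial / Real.pi ^ k * radialEigenvalue C k : ℝ) : ℂ) else 0 := by
  have hpi := Real.pi_pos
  rw [← integral_indicator (measurableSet_radialSet hC), ← integral_comp_polarCoord_symm,
    polarCoord_target]
  have he : ∀ q ∈ Set.Ioi (0 : ℝ) ×ˢ Set.Ioo (-Real.pi) Real.pi,
      q.1 • (radialSet C).indicator (fun p => bargmannVar p ^ k *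
        (starRingEnd ℂ (bargmannVar p)) ^ l *
        ((Real.exp (-Real.pi * (p.1 ^ 2 + p.2 ^ 2)) : ℝ) : ℂ)) (polarCoord.symm q) =
      ((C.indicator (fun _ => (1 : ℝ)) (q.1 ^ 2) *
        (q.1 ^ (k + l + 1) * Real.exp (-Real.pi * q.1 ^ 2)) : ℝ) : ℂ) *
      ((bargmannVar (Real.cos q.2, Real.sin q.2)) ^ k *
      (starRingEnd ℂ (bargmannVar (Real.cos q.2, Real.sin q.2))) ^ l) := by
    rintro ⟨r, θ⟩ -
    have hr : (r * Real.cos θ) ^ 2 + (r * Real.sin θ) ^ 2 = r ^ 2 := by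
      linear_combination r ^ 2 * Real.sin_sq_add_cos_sq θ
    have hz : bargmannVar (r * Real.cos θ, r * Real.sin θ) =
        r * bargmannVar (Real.cos θ, Real.sin θ) := by
      simp only [bargmannVar]; push_cast; ring
    rw [polarCoord_symm_apply]
    by_cases hrC : r ^ 2 ∈ C
    · have hm : (r * Real.cos θ, r * Real.sin θ) ∈ radialSet C := by
        change (r * Real.cos θ) ^ 2 + (r * Real.sin θ) ^ 2 ∈ C
        rwa [hr]
      rw [Set.indicator_of_mem hrC, Set.indicator_of_mem hm, hr, hz, map_mul, Complex.conj_ofReal,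
        Complex.real_smul]
      push_cast
      ring
    · have hm : (r * Real.cos θ, r * Real.sin θ) ∉ radialSet C := by
        change (r * Real.cos θ) ^ 2 + (r * Real.sin θ) ^ 2 ∉ C
        rwa [hr]
      rw [Set.indicator_of_notMem hrC, Set.indicator_of_notMem hm]
      simp
  rw [setIntegral_congr_fun (measurableSet_Ioi.prod measurableSet_Ioo) he, Measure.volume_eq_prod,
    setIntegral_prod_mul (fun r : ℝ => ((C.indicator (fun _ => (1 : ℝ)) (r ^ 2) *
        (r ^ (k + l + 1) * Real.exp (-Real.pi * r ^ 2)) : ℝ) : ℂ))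
      (fun θ : ℝ => (bargmannVar (Real.cos θ, Real.sin θ)) ^ k *
      (starRingEnd ℂ (bargmannVar (Real.cos θ, Real.sin θ))) ^ l),
    integral_unit_pow, integral_complex_ofReal]
  split_ifs with h
  · subst h
    rw [← two_mul, integral_radial hC]
    have : (Real.pi : ℂ) ≠ 0 := by exact_mod_cast hpi.ne'
    push_cast
    field_simp
  · rw [mul_zero]

/-- Pythagoras: the angular integration removes all cross terms. Finite sums suffice, since the full
series is reached by a limit. -/
lemma setIntegral_radialSet_sum {C : Set ℝ} (hC : MeasurableSet C) (hE : IsCompact (radialSet C))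
    (c : ℕ → ℂ) (N : ℕ) :
    ∫ p in radialSet C, Real.exp (-Real.pi * (p.1 ^ 2 + p.2 ^ 2)) *
      ‖∑ k ∈ range N, c k * bargmannVar p ^ k‖ ^ 2 =
    ∑ k ∈ range N, k.factorial / Real.pi ^ k * ‖c k‖ ^ 2 * radialEigenvalue C k := by
  apply Complex.ofReal_injective
  rw [← integral_complex_ofReal]
  have he : ∀ p : ℝ × ℝ, ((Real.exp (-Real.pi * (p.1 ^ 2 + p.2 ^ 2)) *
      ‖∑ k ∈ range N, c k * bargmannVar p ^ k‖ ^ 2 : ℝ) : ℂ) =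
      ∑ k ∈ range N, ∑ l ∈ range N, c k * starRingEnd ℂ (c l) *
        (bargmannVar p ^ k * (starRingEnd ℂ (bargmannVar p)) ^ l *
        ((Real.exp (-Real.pi * (p.1 ^ 2 + p.2 ^ 2)) : ℝ) : ℂ)) := fun p => by
    have hn : ((‖∑ k ∈ range N, c k * bargmannVar p ^ k‖ ^ 2 : ℝ) : ℂ) =
        (∑ k ∈ range N, c k * bargmannVar p ^ k) *
          ∑ l ∈ range N, starRingEnd ℂ (c l) * (starRingEnd ℂ (bargmannVar p)) ^ l := by
      rw [Complex.ofReal_pow, ← Complex.mul_conj', map_sum]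
      simp only [map_mul, map_pow]
    rw [Complex.ofReal_mul, hn, sum_mul_sum, mul_sum]
    refine sum_congr rfl fun k _ => ?_
    rw [mul_sum]
    refine sum_congr rfl fun l _ => ?_
    ring
  have hi : ∀ k l : ℕ, Integrable (fun p : ℝ × ℝ => c k * starRingEnd ℂ (c l) *
        (bargmannVar p ^ k * (starRingEnd ℂ (bargmannVar p)) ^ l *
        ((Real.exp (-Real.pi * (p.1 ^ 2 + p.2 ^ 2)) : ℝ) : ℂ)))
        (volume.restrict (radialSet C)) := fun k l => by
    refine ContinuousOn.integrableOn_compact hE (Continuous.continuousOn ?_)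
    have h1 := continuous_bargmannVar
    have h2 := Complex.continuous_conj.comp h1
    have h3 : Continuous fun p : ℝ × ℝ =>
        ((Real.exp (-Real.pi * (p.1 ^ 2 + p.2 ^ 2)) : ℝ) : ℂ) :=
      Complex.continuous_ofReal.comp (by fun_prop)
    exact continuous_const.mul (((h1.pow k).mul (h2.pow l)).mul h3)
  simp only [he]
  rw [integral_finsetSum _ fun k _ => integrable_finsetSum _ fun l _ => hi k l,
    Complex.ofReal_sum]
  refine sum_congr rfl fun k hk => ?_
  rw [integral_finsetSum _ fun l _ => hi k l]
  simp only [integral_const_mul, setIntegral_radialSet_pow hC]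
  rw [sum_eq_single k]
  · rw [if_pos rfl, Complex.mul_conj']
    push_cast
    ring
  · intro l _ hl
    rw [if_neg hl.symm, mul_zero]
  · exact fun h => absurd hk h

lemma measurable_stft_norm_sq (f : Signal) : Measurable fun p => ‖stft f p‖ ^ 2 :=
  ((stronglyMeasurable_stft f).measurable.norm).pow_const 2

lemma integrableOn_stft_norm_sq {E : Set (ℝ × ℝ)} (hE : IsCompact E) (f : Signal) :
    IntegrableOn (fun p => ‖stft f p‖ ^ 2) E := by
  refine (integrableOn_const (C := ‖f‖ ^ 2) hE.measure_lt_top.ne).mono'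
    (measurable_stft_norm_sq f).aestronglyMeasurable (.of_forall fun p => ?_)
  rw [Real.norm_of_nonneg (by positivity)]
  gcongr
  exact norm_stft_le f p

/-- Bessel's inequality bounds the partial sums and Fatou's lemma passes to the limit, so
completeness of the Hermite functions is not needed. -/
lemma setIntegral_stft_norm_sq_le {C : Set ℝ} (hC : MeasurableSet C)
    (hE : IsCompact (radialSet C)) {Λ : ℝ} (hΛ : ∀ k, radialEigenvalue C k ≤ Λ) (hΛ0 : 0 ≤ Λ)
    (f : Signal) :
    ∫ p in radialSet C, ‖stft f p‖ ^ 2 ≤ Λ * ‖f‖ ^ 2 := by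
  let F : ℕ → ℝ × ℝ → ℝ := fun N p => Real.exp (-Real.pi * (p.1 ^ 2 + p.2 ^ 2)) *
      ‖∑ k ∈ range N, hermiteCoeff f k * bargmannVar p ^ k‖ ^ 2
  have hFc : ∀ N, Continuous (F N) := fun N => by
    have h1 := continuous_bargmannVar
    fun_prop
  have hF0 : ∀ N p, 0 ≤ F N p := fun N p => by positivity
  have hlim : ∀ p, Filter.Tendsto (fun N => F N p) Filter.atTop (nhds (‖stft f p‖ ^ 2)) := by
    intro p
    rw [norm_stft_sq, (hasSum_stft f p).tsum_eq]
    exact (((hasSum_stft f p).tendsto_sum_nat.norm).pow 2).const_mul _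
  have hF : ∀ N, ∫ p in radialSet C, F N p ≤ Λ * ‖f‖ ^ 2 := fun N => by
    rw [setIntegral_radialSet_sum hC hE]
    refine le_trans (sum_le_sum fun k _ => mul_le_mul_of_nonneg_left (hΛ k) (by positivity)) ?_
    rw [← sum_mul, mul_comm]
    exact mul_le_mul_of_nonneg_left (sum_hermiteCoeff_sq_le f N) hΛ0
  have h := lintegral_liminf_le (u := Filter.atTop) (μ := volume.restrict (radialSet C))
    (f := fun N p => ENNReal.ofReal (F N p)) (fun N => (hFc N).measurable.ennreal_ofReal)
  have hl : ∀ p, Filter.liminf (fun N => ENNReal.ofReal (F N p)) Filter.atTop =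
      ENNReal.ofReal (‖stft f p‖ ^ 2) := fun p =>
    ((ENNReal.continuous_ofReal.tendsto _).comp (hlim p)).liminf_eq
  simp only [hl] at h
  rw [← ofReal_integral_eq_lintegral_ofReal (integrableOn_stft_norm_sq hE f)
    (.of_forall fun p => by positivity)] at h
  have h2 : Filter.liminf (fun N => ∫⁻ p in radialSet C, ENNReal.ofReal (F N p)) Filter.atTop ≤
      ENNReal.ofReal (Λ * ‖f‖ ^ 2) := by
    refine Filter.liminf_le_of_frequently_le' (Filter.Frequently.of_forall fun N => ?_)
    rw [← ofReal_integral_eq_lintegral_ofReal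
      ((hFc N).continuousOn.integrableOn_compact hE) (.of_forall (hF0 N))]
    exact ENNReal.ofReal_le_ofReal (hF N)
  exact (ENNReal.ofReal_le_ofReal_iff (by positivity)).1 (h.trans h2)

lemma inner_localizationOp_indicator {E : Set (ℝ × ℝ)} (hE : MeasurableSet E)
    (hF : Integrable (E.indicator fun _ => (1 : ℝ))) (f g : Signal) :
    inner ℂ g (localizationOp (E.indicator fun _ => 1) hF f) =
      ∫ p in E, stft f p * starRingEnd ℂ (stft g p) := by
  rw [inner_localizationOp, ← integral_indicator hE]
  congr 1
  ext p
  by_cases hp : p ∈ E <;> simp [hp]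

theorem norm_localizationOp_radialSet_le {C : Set ℝ} (hC : MeasurableSet C)
    (hE : IsCompact (radialSet C)) {Λ : ℝ} (hΛ : ∀ k, radialEigenvalue C k ≤ Λ) (hΛ0 : 0 ≤ Λ)
    (hF : Integrable ((radialSet C).indicator fun _ => (1 : ℝ))) :
    ‖localizationOp ((radialSet C).indicator fun _ => 1) hF‖ ≤ Λ := by
  refine ContinuousLinearMap.opNorm_le_of_re_inner_le hΛ0 fun f g hf hg => ?_
  have hf2 := setIntegral_stft_norm_sq_le hC hE hΛ hΛ0 f
  have hg2 := setIntegral_stft_norm_sq_le hC hE hΛ hΛ0 g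
  rw [hf] at hf2
  rw [hg] at hg2
  rw [inner_re_symm, inner_localizationOp_indicator (measurableSet_radialSet hC)]
  refine (RCLike.re_le_norm _).trans ?_
  -- Since `f` and `g` are unit vectors, `|ab| ≤ (a² + b²)/2` replaces Cauchy–Schwarz at no loss.
  have hb := (((integrableOn_stft_norm_sq hE f).add (integrableOn_stft_norm_sq hE g)).div_const 2)
  refine (norm_integral_le_of_norm_le hb (.of_forall fun p => ?_)).trans ?_
  · rw [norm_mul, RCLike.norm_conj, Pi.add_apply]
    nlinarith [sq_nonneg (‖stft f p‖ - ‖stft g p‖)]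
  · rw [integral_div]
    simp only [Pi.add_apply]
    rw [integral_add (integrableOn_stft_norm_sq hE f) (integrableOn_stft_norm_sq hE g)]
    linarith

/-- The test vector is the Gaussian itself, whose power series is the constant 1. -/
theorem radialEigenvalue_zero_le_norm {C : Set ℝ} (hC : MeasurableSet C)
    (hE : IsCompact (radialSet C))
    (hF : Integrable ((radialSet C).indicator fun _ => (1 : ℝ))) :
    radialEigenvalue C 0 ≤ ‖localizationOp ((radialSet C).indicator fun _ => 1) hF‖ := by
  have hs : ∀ p, ‖stft (hermiteSignal 0) p‖ ^ 2 = Real.exp (-Real.pi * (p.1 ^ 2 + p.2 ^ 2)) *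
      ‖∑ k ∈ range 1, (1 : ℂ) * bargmannVar p ^ k‖ ^ 2 := fun p => by
    rw [norm_stft_sq, tsum_eq_single 0 fun k hk => by
      rw [hermiteCoeff_hermiteSignal, if_neg hk, zero_mul]]
    rw [hermiteCoeff_hermiteSignal]
    simp
  have h1 : radialEigenvalue C 0 = ∫ p in radialSet C, ‖stft (hermiteSignal 0) p‖ ^ 2 := by
    simp only [hs]
    rw [setIntegral_radialSet_sum hC hE]
    simp
  have h2 : (inner ℂ (hermiteSignal 0) (localizationOp ((radialSet C).indicator fun _ => 1) hF
      (hermiteSignal 0)) : ℂ) = ((radialEigenvalue C 0 : ℝ) : ℂ) := by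
    rw [inner_localizationOp_indicator (measurableSet_radialSet hC), h1, ← integral_complex_ofReal]
    congr 1
    ext p
    rw [Complex.mul_conj', Complex.ofReal_pow]
  have h3 := norm_inner_le_norm (𝕜 := ℂ) (hermiteSignal 0)
    (localizationOp ((radialSet C).indicator fun _ => 1) hF (hermiteSignal 0))
  rw [h2, Complex.norm_real, norm_hermiteSignal_zero, one_mul] at h3
  refine (le_abs_self _).trans (h3.trans ?_)
  refine (ContinuousLinearMap.le_opNorm _ _).trans ?_
  rw [norm_hermiteSignal_zero, mul_one]

/-! ### Gamma densities: moments and variation -/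

lemma continuous_gammaDensity (k : ℕ) : Continuous (gammaDensity k) := by
  unfold gammaDensity
  fun_prop

lemma gammaDensity_nonneg (k : ℕ) {s : ℝ} (hs : 0 ≤ s) : 0 ≤ gammaDensity k s := by
  unfold gammaDensity
  positivity

lemma gammaDensity_le_one (k : ℕ) {s : ℝ} (hs : 0 ≤ s) : gammaDensity k s ≤ 1 := by
  unfold gammaDensity
  calc s ^ k / k.factorial * Real.exp (-s) ≤ Real.exp s * Real.exp (-s) := by
        gcongr
        exact Real.pow_div_factorial_le_exp s hs k
    _ = 1 := by rw [← Real.exp_add, add_neg_cancel, Real.exp_zero]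

/-- Multiplication by `s` raises the shape, so every moment reduces to total masses. -/
lemma mul_gammaDensity (k : ℕ) (s : ℝ) :
    s * gammaDensity k s = ((k : ℝ) + 1) * gammaDensity (k + 1) s := by
  unfold gammaDensity
  have h1 := Nat.cast_ne_zero (R := ℝ).2 k.factorial_ne_zero
  have h2 : (k : ℝ) + 1 ≠ 0 := by positivity
  rw [Nat.factorial_succ]
  push_cast
  field_simp
  ring

lemma integrableOn_gammaDensity (k : ℕ) : IntegrableOn (gammaDensity k) (Set.Ioi 0) := by
  have h := (Real.GammaIntegral_convergent (s := k + 1) (by positivity)).const_mul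
    ((k.factorial : ℝ)⁻¹)
  refine IntegrableOn.congr_fun h (fun s _ => ?_) measurableSet_Ioi
  simp only [gammaDensity, add_sub_cancel_right, Real.rpow_natCast]
  ring

lemma integral_gammaDensity (k : ℕ) : ∫ s in Set.Ioi 0, gammaDensity k s = 1 := by
  have h := Real.Gamma_eq_integral (s := k + 1) (by positivity)
  rw [Real.Gamma_nat_eq_factorial] at h
  have h1 := Nat.cast_ne_zero (R := ℝ).2 k.factorial_ne_zero
  have e : ∀ s, gammaDensity k s =
      (k.factorial : ℝ)⁻¹ * (Real.exp (-s) * s ^ ((k : ℝ) + 1 - 1)) := fun s => by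
    simp only [gammaDensity, add_sub_cancel_right, Real.rpow_natCast]
    ring
  simp only [e]
  rw [integral_const_mul, ← h, inv_mul_cancel₀ h1]

/-- The derivative of `gammaDensity k`. -/
noncomputable def gammaDensityDeriv : ℕ → ℝ → ℝ
  | 0, s => -gammaDensity 0 s
  | k + 1, s => gammaDensity k s - gammaDensity (k + 1) s

lemma continuous_gammaDensityDeriv (k : ℕ) : Continuous (gammaDensityDeriv k) := by
  rcases k with _ | k
  · exact (continuous_gammaDensity 0).neg
  · exact (continuous_gammaDensity k).sub (continuous_gammaDensity (k + 1))

lemma mul_gammaDensityDeriv (k : ℕ) (s : ℝ) :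
    s * gammaDensityDeriv k s = (k - s) * gammaDensity k s := by
  rcases k with _ | k
  · simp [gammaDensityDeriv]
  · rw [gammaDensityDeriv, mul_sub, mul_gammaDensity]
    push_cast
    ring

lemma hasDerivAt_gammaDensity (k : ℕ) (s : ℝ) :
    HasDerivAt (gammaDensity k) (gammaDensityDeriv k s) s := by
  have h := ((hasDerivAt_pow k s).div_const (k.factorial : ℝ)).mul (hasDerivAt_neg s).exp
  refine h.congr_deriv ?_
  rcases k with _ | k
  · simp [gammaDensityDeriv, gammaDensity]
  · unfold gammaDensityDeriv gammaDensity
    have h1 := Nat.cast_ne_zero (R := ℝ).2 k.factorial_ne_zero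
    have h2 : (k : ℝ) + 1 ≠ 0 := by positivity
    have h3 : ((k + 1).factorial : ℝ) = ((k : ℝ) + 1) * k.factorial := by
      exact_mod_cast Nat.factorial_succ k
    simp only [h3, Nat.add_sub_cancel, Nat.cast_add_one]
    field_simp
    ring

lemma sq_sub_mul_gammaDensity (k : ℕ) (b s : ℝ) :
    (s - b) ^ 2 * gammaDensity k s = ((k : ℝ) + 1) * (k + 2) * gammaDensity (k + 2) s -
      2 * b * (k + 1) * gammaDensity (k + 1) s + b ^ 2 * gammaDensity k s := by
  have h1 := mul_gammaDensity k s
  have h2 := mul_gammaDensity (k + 1) s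
  push_cast at h2
  linear_combination (s - 2 * b) * h1 + ((k : ℝ) + 1) * h2

lemma integrableOn_sq_sub_mul_gammaDensity (k : ℕ) (b : ℝ) :
    IntegrableOn (fun s => (s - b) ^ 2 * gammaDensity k s) (Set.Ioi 0) := by
  simp only [sq_sub_mul_gammaDensity]
  exact (((integrableOn_gammaDensity _).const_mul _).sub
    ((integrableOn_gammaDensity _).const_mul _)).add ((integrableOn_gammaDensity _).const_mul _)

lemma integral_sq_sub_mul_gammaDensity (k : ℕ) (b : ℝ) :
    ∫ s in Set.Ioi 0, (s - b) ^ 2 * gammaDensity k s =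
      ((k : ℝ) + 1) * (k + 2) - 2 * b * (k + 1) + b ^ 2 := by
  have h0 := fun (j : ℕ) (c : ℝ) => (integrableOn_gammaDensity j).const_mul c
  simp only [sq_sub_mul_gammaDensity]
  have h1 : Integrable (fun s => ((k : ℝ) + 1) * (k + 2) * gammaDensity (k + 2) s -
      2 * b * (k + 1) * gammaDensity (k + 1) s) (volume.restrict (Set.Ioi 0)) :=
    (h0 (k + 2) _).sub (h0 (k + 1) _)
  rw [integral_add h1 (h0 k (b ^ 2)), integral_sub (h0 (k + 2) (((k : ℝ) + 1) * (k + 2)))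
    (h0 (k + 1) (2 * b * (k + 1))), integral_const_mul, integral_const_mul, integral_const_mul]
  simp only [integral_gammaDensity, mul_one]

lemma abs_sub_mul_gammaDensity_le (k : ℕ) (b : ℝ) {c s : ℝ} (hc : 0 < c) (hs : 0 ≤ s) :
    |s - b| * gammaDensity k s ≤
      c / 2 * gammaDensity k s + (2 * c)⁻¹ * ((s - b) ^ 2 * gammaDensity k s) := by
  rw [← mul_assoc, ← add_mul]
  refine mul_le_mul_of_nonneg_right ?_ (gammaDensity_nonneg k hs)
  have h : |s - b| = (c / 2 + (2 * c)⁻¹ * (s - b) ^ 2) - (2 * c)⁻¹ * (|s - b| - c) ^ 2 := by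
    rw [← sq_abs (s - b)]
    field_simp
    ring
  have : 0 ≤ (2 * c)⁻¹ * (|s - b| - c) ^ 2 := by positivity
  linarith

lemma integrableOn_abs_sub_mul_gammaDensity (k : ℕ) (b : ℝ) :
    IntegrableOn (fun s => |s - b| * gammaDensity k s) (Set.Ioi 0) := by
  refine (((integrableOn_gammaDensity k).const_mul (1 / 2)).add
    ((integrableOn_sq_sub_mul_gammaDensity k b).const_mul (2 * 1)⁻¹)).mono' ?_ ?_
  · have := continuous_gammaDensity k
    exact (by fun_prop : Continuous fun s => |s - b| * gammaDensity k s).aestronglyMeasurable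
  · refine (ae_restrict_mem measurableSet_Ioi).mono fun s hs => ?_
    have hs' : (0 : ℝ) ≤ s := le_of_lt hs
    rw [Real.norm_of_nonneg (mul_nonneg (abs_nonneg _) (gammaDensity_nonneg k hs'))]
    exact abs_sub_mul_gammaDensity_le k b one_pos hs'

/-- First absolute moment from the second, by integrating `|u| ≤ c/2 + u²/(2c)`; `hV` says that the
second moment about `b` is at most `c²`. -/
lemma integral_abs_sub_mul_gammaDensity_le (k : ℕ) (b : ℝ) {c : ℝ} (hc : 0 < c)
    (hV : ((k : ℝ) + 1) * (k + 2) - 2 * b * (k + 1) + b ^ 2 ≤ c ^ 2) :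
    ∫ s in Set.Ioi 0, |s - b| * gammaDensity k s ≤ c := by
  have hi := ((integrableOn_gammaDensity k).const_mul (c / 2))
  have hj := ((integrableOn_sq_sub_mul_gammaDensity k b).const_mul (2 * c)⁻¹)
  refine (setIntegral_mono_on (integrableOn_abs_sub_mul_gammaDensity k b) (hi.add hj)
    measurableSet_Ioi fun s hs => abs_sub_mul_gammaDensity_le k b hc (le_of_lt hs)).trans ?_
  simp only [Pi.add_apply]
  rw [integral_add hi hj, integral_const_mul, integral_const_mul, integral_gammaDensity,
    integral_sq_sub_mul_gammaDensity]
  have h : (2 * c)⁻¹ * (((k : ℝ) + 1) * (k + 2) - 2 * b * (k + 1) + b ^ 2) ≤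
      (2 * c)⁻¹ * c ^ 2 := by gcongr
  have e : (2 * c)⁻¹ * c ^ 2 = c / 2 := by field_simp
  linarith

lemma integrableOn_abs_gammaDensityDeriv (k : ℕ) :
    IntegrableOn (fun s => |gammaDensityDeriv k s|) (Set.Ioi 0) := by
  rcases k with _ | k
  · exact (integrableOn_gammaDensity 0).neg.abs
  · exact ((integrableOn_gammaDensity k).sub (integrableOn_gammaDensity (k + 1))).abs

/-- For positive shape index the derivative is a difference of two probability densities. -/
lemma integral_abs_gammaDensityDeriv_le_two (k : ℕ) :
    ∫ s in Set.Ioi 0, |gammaDensityDeriv k s| ≤ 2 := by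
  rcases k with _ | k
  · have : ∫ s in Set.Ioi 0, |gammaDensityDeriv 0 s| = ∫ s in Set.Ioi 0, gammaDensity 0 s :=
      setIntegral_congr_fun measurableSet_Ioi fun s hs => by
        simp only [gammaDensityDeriv, abs_neg]
        exact abs_of_nonneg (gammaDensity_nonneg 0 (le_of_lt hs))
    rw [this, integral_gammaDensity]
    norm_num
  · have h := setIntegral_mono_on (integrableOn_abs_gammaDensityDeriv (k + 1))
      ((integrableOn_gammaDensity k).add (integrableOn_gammaDensity (k + 1))) measurableSet_Ioi
      fun s hs => by
        have h1 := gammaDensity_nonneg k (le_of_lt hs)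
        have h2 := gammaDensity_nonneg (k + 1) (le_of_lt hs)
        simp only [gammaDensityDeriv, Pi.add_apply]
        exact abs_le.2 ⟨by linarith, by linarith⟩
    refine h.trans ?_
    simp only [Pi.add_apply]
    rw [integral_add (integrableOn_gammaDensity k) (integrableOn_gammaDensity (k + 1)),
      integral_gammaDensity, integral_gammaDensity]
    norm_num

/-- A bound for the variation of the Gamma densities on `(a, ∞)`, uniform in the shape. -/
noncomputable def tailVariation (a : ℝ) : ℝ := √(a + 2) / a + 1 / √a

lemma integral_abs_gammaDensityDeriv_le_tailVariation (k : ℕ) {a : ℝ} (ha : 0 < a) :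
    ∫ s in Set.Ioi a, |gammaDensityDeriv k s| ≤ tailVariation a := by
  have hsub : Set.Ioi a ⊆ Set.Ioi 0 := Set.Ioi_subset_Ioi ha.le
  have hc : 0 < √(a + 2) := Real.sqrt_pos.2 (by linarith)
  have hsa : 0 < √a := Real.sqrt_pos.2 ha
  unfold tailVariation
  rcases le_total a k with hk | hk
  -- Large shape: the variation over the whole half-line is already small. The derivative is `-(s -
  -- k) γ_{k-1}(s) / k`, and `γ_{k-1}` has mean and variance `k`, which gives `1/√k ≤ 1/√a`.
  · obtain ⟨j, rfl⟩ : ∃ j, k = j + 1 := Nat.exists_eq_succ_of_ne_zero (by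
      rintro rfl
      simp only [Nat.cast_zero] at hk
      linarith)
    have hK : (0 : ℝ) < (j : ℝ) + 1 := by positivity
    have h1 := integral_abs_sub_mul_gammaDensity_le j ((j : ℝ) + 1) (Real.sqrt_pos.2 hK)
      (by rw [Real.sq_sqrt hK.le]; linarith)
    have h2 : ∫ s in Set.Ioi a, |gammaDensityDeriv (j + 1) s| ≤
        ∫ s in Set.Ioi 0, |gammaDensityDeriv (j + 1) s| :=
      setIntegral_mono_set (integrableOn_abs_gammaDensityDeriv _)
        (.of_forall fun _ => abs_nonneg _) hsub.eventuallyLE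
    have h3 : ∫ s in Set.Ioi 0, |gammaDensityDeriv (j + 1) s| =
        ((j : ℝ) + 1)⁻¹ * ∫ s in Set.Ioi 0, |s - ((j : ℝ) + 1)| * gammaDensity j s := by
      rw [← integral_const_mul]
      refine setIntegral_congr_fun measurableSet_Ioi fun s hs => ?_
      have e : gammaDensityDeriv (j + 1) s =
          ((j : ℝ) + 1)⁻¹ * (-(s - ((j : ℝ) + 1)) * gammaDensity j s) := by
        have := mul_gammaDensity j s
        rw [gammaDensityDeriv]
        field_simp
        linarith
      simp only [e]
      rw [abs_mul, abs_mul, abs_neg, abs_of_pos (inv_pos.2 hK),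
        abs_of_nonneg (gammaDensity_nonneg j (le_of_lt hs))]
    have h4 : ((j : ℝ) + 1)⁻¹ * √((j : ℝ) + 1) = 1 / √((j : ℝ) + 1) := by
      rw [← Real.sqrt_div_self', inv_mul_eq_div]
    have h5 : 1 / √((j : ℝ) + 1) ≤ 1 / √a := by
      push_cast at hk
      gcongr
    have h6 : ((j : ℝ) + 1)⁻¹ * ∫ s in Set.Ioi 0, |s - ((j : ℝ) + 1)| * gammaDensity j s ≤
        ((j : ℝ) + 1)⁻¹ * √((j : ℝ) + 1) := by gcongr
    have : 0 ≤ √(a + 2) / a := by positivity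
    linarith
  -- Small shape: for `s > a` the derivative is at most `|s - k| γ_k(s) / a`, and the second moment
  -- of `γ_k` about `k` is `k + 2 ≤ a + 2`.
  · have h1 := integral_abs_sub_mul_gammaDensity_le k k hc
      (by rw [Real.sq_sqrt (by linarith)]; nlinarith)
    have h2 : ∫ s in Set.Ioi a, |gammaDensityDeriv k s| ≤
        ∫ s in Set.Ioi a, a⁻¹ * (|s - k| * gammaDensity k s) := by
      refine setIntegral_mono_on ((integrableOn_abs_gammaDensityDeriv k).mono_set hsub)
        (((integrableOn_abs_sub_mul_gammaDensity k k).mono_set hsub).const_mul _)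
        measurableSet_Ioi fun s hs => ?_
      have hs' : a < s := hs
      have e := congrArg abs (mul_gammaDensityDeriv k s)
      rw [abs_mul, abs_mul, abs_of_pos (ha.trans hs'),
        abs_of_nonneg (gammaDensity_nonneg k (ha.trans hs').le), abs_sub_comm] at e
      rw [← e, inv_mul_eq_div, le_div_iff₀ ha]
      nlinarith [abs_nonneg (gammaDensityDeriv k s)]
    have h3 : ∫ s in Set.Ioi a, |s - (k : ℝ)| * gammaDensity k s ≤
        ∫ s in Set.Ioi (0 : ℝ), |s - k| * gammaDensity k s :=
      setIntegral_mono_set (integrableOn_abs_sub_mul_gammaDensity k k)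
        ((ae_restrict_mem measurableSet_Ioi).mono fun s hs =>
          mul_nonneg (abs_nonneg _) (gammaDensity_nonneg k (le_of_lt hs))) hsub.eventuallyLE
    rw [integral_const_mul] at h2
    have h4 : a⁻¹ * ∫ s in Set.Ioi a, |s - k| * gammaDensity k s ≤ a⁻¹ * √(a + 2) := by
      gcongr
      exact h3.trans h1
    have h5 : a⁻¹ * √(a + 2) = √(a + 2) / a := by ring
    have : 0 ≤ 1 / √a := by positivity
    linarith

lemma tendsto_tailVariation : Filter.Tendsto tailVariation Filter.atTop (nhds 0) := by
  have h1 : Filter.Tendsto (fun a : ℝ => 1 / √a) Filter.atTop (nhds 0) := by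
    simp only [one_div]
    exact tendsto_inv_atTop_zero.comp Real.tendsto_sqrt_atTop
  have h2 : Filter.Tendsto (fun a : ℝ => √3 * (1 / √a) + 1 / √a) Filter.atTop (nhds 0) := by
    simpa using (h1.const_mul √3).add h1
  refine squeeze_zero' ?_ ?_ h2
  · filter_upwards [Filter.eventually_ge_atTop 0] with a ha
    unfold tailVariation
    positivity
  · filter_upwards [Filter.eventually_ge_atTop 1] with a ha
    unfold tailVariation
    gcongr
    have ha0 : 0 < a := by linarith
    rw [← Real.sqrt_div_self', ← mul_div_assoc, ← Real.sqrt_mul (by norm_num)]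
    gcongr
    linarith

/-! ### Mean and variation on an interval -/

/-- The value of a function with integrable derivative is at most its mean plus its variation. -/
lemma le_average_add_variation {w w' : ℝ → ℝ} (hw : ∀ s, HasDerivAt w (w' s) s)
    (hw' : Continuous w') {a b s : ℝ} (hab : a < b) (hs : s ∈ Set.Icc a b) :
    w s ≤ (b - a)⁻¹ * (∫ t in a..b, w t) + ∫ t in a..b, |w' t| := by
  have hwc : Continuous w := continuous_iff_continuousAt.2 fun s => (hw s).continuousAt
  have h1 : ∀ t ∈ Set.Icc a b, w s ≤ w t + ∫ t in a..b, |w' t| := by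
    intro t ht
    have e := intervalIntegral.integral_eq_sub_of_hasDerivAt (a := t) (b := s)
      (fun x _ => hw x) (hw'.intervalIntegrable _ _)
    have h2 := intervalIntegral.norm_integral_le_abs_integral_norm (f := w') (a := t) (b := s)
      (μ := volume)
    simp only [Real.norm_eq_abs] at h2
    have h3 := intervalIntegral.abs_integral_mono_interval (f := fun x => |w' x|) (μ := volume)
      (a := t) (b := s) (c := a) (d := b)
      (Set.uIoc_subset_uIoc_of_uIcc_subset_uIcc (Set.uIcc_subset_uIcc
        (by rwa [Set.uIcc_of_le hab.le]) (by rwa [Set.uIcc_of_le hab.le])))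
      (.of_forall fun _ => abs_nonneg _) (hw'.abs.intervalIntegrable _ _)
    have h4 : 0 ≤ ∫ x in a..b, |w' x| :=
      intervalIntegral.integral_nonneg hab.le fun _ _ => abs_nonneg _
    rw [abs_of_nonneg h4] at h3
    have h6 := h2.trans h3
    have h5 := le_abs_self (∫ x in t..s, w' x)
    linarith
  -- Averaging `h1` over `t` turns `w t` into the mean.
  have h2 := intervalIntegral.integral_mono_on hab.le
    (continuous_const.intervalIntegrable (μ := volume) a b)
    ((hwc.add continuous_const).intervalIntegrable (μ := volume) a b) h1
  simp only [Pi.add_apply] at h2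
  rw [intervalIntegral.integral_const, intervalIntegral.integral_add
    (hwc.intervalIntegrable _ _) (continuous_const.intervalIntegrable _ _),
    intervalIntegral.integral_const, smul_eq_mul, smul_eq_mul] at h2
  have hba : 0 < b - a := sub_pos.2 hab
  have h3 := mul_le_mul_of_nonneg_left h2 (inv_pos.2 hba).le
  rw [mul_add, inv_mul_cancel_left₀ hba.ne', inv_mul_cancel_left₀ hba.ne'] at h3
  exact h3

/-! ### Digit combinatorics and integrals over Cantor iterates -/

/-- The discrete Cantor set as a `Finset`. -/
noncomputable def cantorFinset (n M : ℕ) (A : Finset ℕ) : Finset ℕ :=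
  (finite_discreteCantor n M A).toFinset

lemma mem_cantorFinset {n M : ℕ} {A : Finset ℕ} {x : ℕ} :
    x ∈ cantorFinset n M A ↔ x ∈ discreteCantor n M A :=
  Set.Finite.mem_toFinset _

lemma cantorFinset_zero (M : ℕ) (A : Finset ℕ) : cantorFinset 0 M A = {0} := by
  ext x
  simp [mem_cantorFinset, discreteCantor]

/-- Splits off the least significant digit, so refinement becomes `y ↦ M y + a`. -/
lemma cantorFinset_succ (n M : ℕ) (A : Finset ℕ) :
    cantorFinset (n + 1) M A = (cantorFinset n M A ×ˢ A).image fun q => M * q.1 + q.2 := by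
  ext x
  simp only [mem_cantorFinset, mem_image, mem_product, Prod.exists, discreteCantor,
    Set.mem_ofPred_eq]
  constructor
  · rintro ⟨a, ha, rfl⟩
    refine ⟨∑ j : Fin n, a j.succ * M ^ (j : ℕ), a 0, ⟨⟨fun j => a j.succ, fun j => ha _, rfl⟩,
      ha 0⟩, ?_⟩
    rw [Fin.sum_univ_succ, mul_sum, add_comm]
    simp only [Fin.val_zero, pow_zero, mul_one, Fin.val_succ, pow_succ]
    congr 1
    exact sum_congr rfl fun j _ => by ring
  · rintro ⟨y, b, ⟨⟨a, ha, rfl⟩, hb⟩, rfl⟩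
    refine ⟨Fin.cons b a, fun j => ?_, ?_⟩
    · refine Fin.cases ?_ (fun i => ?_) j
      · simpa using hb
      · simpa using ha i
    · rw [Fin.sum_univ_succ, mul_sum, add_comm]
      simp only [Fin.val_zero, pow_zero, mul_one, Fin.val_succ, pow_succ, Fin.cons_zero,
        Fin.cons_succ]
      congr 1
      exact sum_congr rfl fun j _ => by ring

lemma sum_cantorFinset_succ {E : Type*} [AddCommMonoid E] (n : ℕ) {M : ℕ} {A : Finset ℕ}
    (hA : A ⊆ range M) (F : ℕ → E) :
    ∑ x ∈ cantorFinset (n + 1) M A, F x =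
      ∑ y ∈ cantorFinset n M A, ∑ a ∈ A, F (M * y + a) := by
  rw [cantorFinset_succ, sum_image, sum_product]
  rintro ⟨y, a⟩ h1 ⟨z, b⟩ h2 h
  simp only [coe_product, Set.mem_prod, mem_coe] at h1 h2 h
  have ha := mem_range.1 (hA h1.2)
  have hb := mem_range.1 (hA h2.2)
  have hM : 0 < M := by omega
  have e1 := congrArg (· % M) h
  have e2 := congrArg (· / M) h
  simp only [Nat.mul_add_mod, Nat.mod_eq_of_lt ha, Nat.mod_eq_of_lt hb] at e1
  simp only [Nat.mul_add_div hM, Nat.div_eq_of_lt ha, Nat.div_eq_of_lt hb, add_zero] at e2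
  rw [e1, e2]

/-- Division by `M ^ q` erases the last `q` digits, and each coarse point has `A.card ^ q`
refinements. -/
lemma sum_cantorFinset_add {E : Type*} [AddCommMonoid E] (i q : ℕ) {M : ℕ} {A : Finset ℕ}
    (hA : A ⊆ range M) (h : ℕ → E) :
    ∑ x ∈ cantorFinset (i + q) M A, h (x / M ^ q) =
      A.card ^ q • ∑ y ∈ cantorFinset i M A, h y := by
  induction q with
  | zero => simp
  | succ q ih =>
    rw [← add_assoc, sum_cantorFinset_succ _ hA, pow_succ' A.card q, mul_smul, ← ih, smul_sum]
    refine sum_congr rfl fun y _ => ?_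
    rw [← sum_const]
    refine sum_congr rfl fun a ha => ?_
    have ha := mem_range.1 (hA ha)
    rw [pow_succ', ← Nat.div_div_eq_div_mul, Nat.mul_add_div (by omega), Nat.div_eq_of_lt ha,
      add_zero]

lemma card_cantorFinset (n : ℕ) {M : ℕ} {A : Finset ℕ} (hA : A ⊆ range M) :
    (cantorFinset n M A).card = A.card ^ n := by
  have h := sum_cantorFinset_add 0 n hA (fun _ => 1)
  rw [zero_add, cantorFinset_zero] at h
  simpa using h

/-- A leading digit 0 may be added. -/
lemma cantorFinset_subset_succ {M : ℕ} {A : Finset ℕ} (h0 : 0 ∈ A) (n : ℕ) :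
    cantorFinset n M A ⊆ cantorFinset (n + 1) M A := by
  induction n with
  | zero =>
    rw [cantorFinset_succ, cantorFinset_zero]
    intro x hx
    rw [mem_singleton] at hx
    subst hx
    exact mem_image.2 ⟨(0, 0), by simp [h0], by simp⟩
  | succ n ih =>
    rw [cantorFinset_succ, cantorFinset_succ (n + 1)]
    exact image_subset_image (product_subset_product ih subset_rfl)

lemma cantorFinset_mono {M : ℕ} {A : Finset ℕ} (h0 : 0 ∈ A) {n n' : ℕ} (h : n ≤ n') :
    cantorFinset n M A ⊆ cantorFinset n' M A :=
  monotone_nat_of_le_succ (cantorFinset_subset_succ h0) h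

lemma lt_of_mem_cantorFinset {n M : ℕ} {A : Finset ℕ} (hA : A ⊆ range M) {x : ℕ}
    (hx : x ∈ cantorFinset n M A) : x + 1 ≤ M ^ n := by
  induction n generalizing x with
  | zero =>
    rw [cantorFinset_zero, mem_singleton] at hx
    simp [hx]
  | succ n ih =>
    rw [cantorFinset_succ, mem_image] at hx
    obtain ⟨⟨y, a⟩, h, rfl⟩ := hx
    rw [mem_product] at h
    have ha := mem_range.1 (hA h.2)
    have hy := Nat.mul_le_mul_left M (ih h.1)
    rw [pow_succ']
    simp only at ha hy ⊢
    linarith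

/-- The leading digit is at least `M - m ≥ 1`. -/
lemma le_of_mem_cantorFinset_reverseAlphabet {n M m : ℕ} (hmM : m < M) {x : ℕ}
    (hx : x ∈ cantorFinset (n + 1) M (reverseAlphabet M m)) : M ^ n ≤ x := by
  induction n generalizing x with
  | zero =>
    rw [cantorFinset_succ, mem_image] at hx
    obtain ⟨⟨y, a⟩, h, rfl⟩ := hx
    rw [mem_product, reverseAlphabet, mem_Ico] at h
    simp only [pow_zero] at h ⊢
    omega
  | succ n ih =>
    rw [cantorFinset_succ, mem_image] at hx
    obtain ⟨⟨y, a⟩, h, rfl⟩ := hx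
    rw [mem_product] at h
    rw [pow_succ']
    exact (Nat.mul_le_mul_left M (ih h.1)).trans (Nat.le_add_right _ _)

lemma cantorIterate_eq (n : ℕ) (L : ℝ) (M : ℕ) (A : Finset ℕ) :
    cantorIterate n L M A = ⋃ x ∈ cantorFinset n M A,
      Set.Icc (L / (M : ℝ) ^ n * x) (L / (M : ℝ) ^ n * (x + 1)) := by
  simp only [cantorIterate, mem_cantorFinset, mul_add, mul_one, div_eq_mul_inv]

/-- Adjacent closed intervals may share endpoints; half-open ones are disjoint and differ from them
by a null set. -/
lemma setIntegral_biUnion_Icc (D : Finset ℕ) {d : ℝ} (hd : 0 ≤ d) {f : ℝ → ℝ}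
    (hf : Continuous f) :
    ∫ t in ⋃ x ∈ D, Set.Icc (d * x) (d * (x + 1)), f t =
      ∑ x ∈ D, ∫ t in (d * x)..(d * (x + 1)), f t := by
  have h : (⋃ x ∈ D, Set.Icc (d * (x : ℝ)) (d * (x + 1))) =ᵐ[volume]
      ⋃ x ∈ D, Set.Ioc (d * (x : ℝ)) (d * (x + 1)) :=
    Filter.EventuallyEq.countable_bUnion D.countable_toSet fun x _ => Ioc_ae_eq_Icc.symm
  rw [setIntegral_congr_set h, integral_biUnion_finset D (fun _ _ => measurableSet_Ioc)]
  · refine sum_congr rfl fun x _ => ?_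
    rw [intervalIntegral.integral_of_le (by nlinarith)]
  · intro x _ y _ hxy
    rw [Function.onFun, Set.disjoint_left]
    rintro t ⟨h1, h2⟩ ⟨h3, h4⟩
    rcases lt_or_gt_of_ne hxy with h | h
    · have : (x : ℝ) + 1 ≤ y := by exact_mod_cast h
      nlinarith
    · have : (y : ℝ) + 1 ≤ x := by exact_mod_cast h
      nlinarith
  · exact fun x _ => (hf.continuousOn.integrableOn_compact isCompact_Icc).mono_set
      Set.Ioc_subset_Icc_self

lemma setIntegral_cantorIterate (n : ℕ) {L : ℝ} (hL : 0 ≤ L) (M : ℕ) (A : Finset ℕ) {f : ℝ → ℝ}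
    (hf : Continuous f) :
    ∫ t in cantorIterate n L M A, f t = ∑ x ∈ cantorFinset n M A,
      ∫ t in (L / (M : ℝ) ^ n * x)..(L / (M : ℝ) ^ n * (x + 1)), f t := by
  rw [cantorIterate_eq, setIntegral_biUnion_Icc _ (by positivity) hf]

/-- The integral over a Cantor iterate is controlled by the mean and the variation
over a coarser iterate. -/
lemma setIntegral_cantorIterate_le {i q M : ℕ} {A : Finset ℕ} (hA : A ⊆ range M) (hM : 0 < M)
    {L : ℝ} (hL : 0 < L) {w w' : ℝ → ℝ} (hw : ∀ s, HasDerivAt w (w' s) s) (hw' : Continuous w') :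
    ∫ t in cantorIterate (i + q) L M A, w t ≤ L / (M : ℝ) ^ (i + q) * (A.card : ℝ) ^ q *
      ((L / (M : ℝ) ^ i)⁻¹ * (∫ t in cantorIterate i L M A, w t) +
        ∫ t in cantorIterate i L M A, |w' t|) := by
  have hM0 : (0 : ℝ) < M := by exact_mod_cast hM
  have hwc : Continuous w := continuous_iff_continuousAt.2 fun s => (hw s).continuousAt
  rw [setIntegral_cantorIterate _ hL.le _ _ hwc, setIntegral_cantorIterate _ hL.le _ _ hwc,
    setIntegral_cantorIterate _ hL.le _ _ hw'.abs]
  set d := L / (M : ℝ) ^ (i + q) with hd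
  set e := L / (M : ℝ) ^ i with he
  have hd0 : 0 < d := by positivity
  have he0 : 0 < e := by positivity
  have hde : e = d * (M : ℝ) ^ q := by
    rw [hd, he, pow_add]
    field_simp
  have hs := sum_cantorFinset_add i q hA (fun y : ℕ => e⁻¹ * (∫ t in (e * y)..(e * (y + 1)), w t) +
    ∫ t in (e * y)..(e * (y + 1)), |w' t|)
  rw [nsmul_eq_mul, Nat.cast_pow] at hs
  rw [mul_sum, ← sum_add_distrib, mul_assoc, ← hs, mul_sum]
  refine sum_le_sum fun x _ => ?_
  -- The index of the coarse interval containing the fine interval of index `x`.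
  set y := x / M ^ q with hy
  have hy1 : (y : ℝ) * (M : ℝ) ^ q ≤ x := by exact_mod_cast Nat.div_mul_le_self x (M ^ q)
  have hy2 : (x : ℝ) + 1 ≤ (y + 1) * (M : ℝ) ^ q := by
    have := Nat.lt_div_mul_add (a := x) (b := M ^ q) (by positivity)
    have h2 : x + 1 ≤ (y + 1) * M ^ q := by
      rw [add_mul, one_mul]
      exact this
    exact_mod_cast h2
  have hdx : d * x ≤ d * (x + 1) := by nlinarith
  have hb : ∀ t ∈ Set.Icc (d * (x : ℝ)) (d * (x + 1)), w t ≤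
      e⁻¹ * (∫ t in (e * y)..(e * (y + 1)), w t) + ∫ t in (e * y)..(e * (y + 1)), |w' t| := by
    intro t ht
    have h := le_average_add_variation hw hw' (a := e * y) (b := e * (y + 1)) (s := t)
      (by nlinarith) ⟨by rw [hde]; nlinarith [ht.1], by rw [hde]; nlinarith [ht.2]⟩
    rwa [show e * ((y : ℝ) + 1) - e * y = e by ring] at h
  have h := intervalIntegral.integral_mono_on hdx (hwc.intervalIntegrable (μ := volume) _ _)
    (continuous_const.intervalIntegrable (μ := volume) _ _) hb
  rw [intervalIntegral.integral_const, smul_eq_mul,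
    show d * ((x : ℝ) + 1) - d * x = d by ring] at h
  exact h

lemma cantorIterate_subset_Ici (n : ℕ) {L : ℝ} (hL : 0 ≤ L) (M : ℕ) (A : Finset ℕ) :
    cantorIterate n L M A ⊆ Set.Ici 0 := by
  rw [cantorIterate_eq]
  intro t ht
  simp only [Set.mem_iUnion] at ht
  obtain ⟨x, _, h1, _⟩ := ht
  exact le_trans (by positivity) h1

lemma cantorIterate_reverseAlphabet_subset (n : ℕ) {L : ℝ} (hL : 0 ≤ L) {M m : ℕ} (hmM : m < M) :
    cantorIterate (n + 1) L M (reverseAlphabet M m) ⊆ Set.Ici (L / M) := by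
  rw [cantorIterate_eq]
  intro t ht
  simp only [Set.mem_iUnion] at ht
  obtain ⟨x, hx, h1, _⟩ := ht
  have hM0 : (0 : ℝ) < M := by exact_mod_cast (Nat.zero_le m).trans_lt hmM
  have h2 : (M : ℝ) ^ n ≤ x := by
    exact_mod_cast le_of_mem_cantorFinset_reverseAlphabet hmM hx
  refine le_trans ?_ h1
  calc L / M = L / (M : ℝ) ^ (n + 1) * (M : ℝ) ^ n := by rw [pow_succ]; field_simp
    _ ≤ _ := by gcongr

lemma setIntegral_le_of_subset_Ici {f : ℝ → ℝ} {a : ℝ} {C : Set ℝ} (hC : C ⊆ Set.Ici a)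
    (hf : IntegrableOn f (Set.Ioi a)) (h0 : ∀ s, a ≤ s → 0 ≤ f s) :
    ∫ t in C, f t ≤ ∫ t in Set.Ioi a, f t := by
  rw [← integral_Ici_eq_integral_Ioi]
  exact setIntegral_mono_set (integrableOn_Ici_iff_integrableOn_Ioi (by simp) |>.2 hf)
    ((ae_restrict_mem measurableSet_Ici).mono fun s hs => h0 s hs) hC.eventuallyLE

/-- The factor `π` in the Gamma variable rescales the base interval to `[0, πR²]`, the effective
length from here on. -/
lemma radialEigenvalue_cantorIterate (n : ℕ) {R : ℝ} (M : ℕ) (A : Finset ℕ) (k : ℕ) :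
    radialEigenvalue (cantorIterate n (R ^ 2) M A) k =
      ∫ t in cantorIterate n (Real.pi * R ^ 2) M A, gammaDensity k t := by
  have hpi := Real.pi_pos
  have h1 : (fun s => s / Real.pi) ⁻¹' cantorIterate n (R ^ 2) M A =
      cantorIterate n (Real.pi * R ^ 2) M A := by
    ext s
    simp only [cantorIterate_eq, Set.mem_preimage, Set.mem_iUnion, Set.mem_Icc, le_div_iff₀ hpi,
      div_le_iff₀ hpi]
    refine exists_congr fun x => exists_congr fun _ => ?_
    rw [show R ^ 2 / (M : ℝ) ^ n * x * Real.pi = Real.pi * R ^ 2 / (M : ℝ) ^ n * x by ring,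
      show R ^ 2 / (M : ℝ) ^ n * (x + 1) * Real.pi =
        Real.pi * R ^ 2 / (M : ℝ) ^ n * (x + 1) by ring]
  have h2 : (Set.Ioi 0 ∩ cantorIterate n (Real.pi * R ^ 2) M A : Set ℝ) =ᵐ[volume]
      cantorIterate n (Real.pi * R ^ 2) M A := by
    have h3 : (Set.Ici 0 ∩ cantorIterate n (Real.pi * R ^ 2) M A : Set ℝ) =
        cantorIterate n (Real.pi * R ^ 2) M A :=
      Set.inter_eq_self_of_subset_right (cantorIterate_subset_Ici n (by positivity) M A)
    have h4 : (Set.Ioi 0 ∩ cantorIterate n (Real.pi * R ^ 2) M A : Set ℝ) =ᵐ[volume]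
        (Set.Ici 0 ∩ cantorIterate n (Real.pi * R ^ 2) M A : Set ℝ) :=
      Ioi_ae_eq_Ici.inter (Filter.EventuallyEq.refl _ _)
    rwa [h3] at h4
  rw [radialEigenvalue, h1, setIntegral_congr_set h2]

lemma norm_cantorLocalizationOp_le (n : ℕ) (R : ℝ) (M : ℕ) (A : Finset ℕ) {Λ : ℝ} (hΛ0 : 0 ≤ Λ)
    (hΛ : ∀ k, ∫ t in cantorIterate n (Real.pi * R ^ 2) M A, gammaDensity k t ≤ Λ) :
    ‖cantorLocalizationOp n R M A‖ ≤ Λ :=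
  norm_localizationOp_radialSet_le (isCompact_cantorIterate n (R ^ 2) M A).measurableSet
    (isCompact_sphericalCantor n R M A)
    (fun k => (radialEigenvalue_cantorIterate n M A k).trans_le (hΛ k)) hΛ0 _

lemma le_norm_cantorLocalizationOp (n : ℕ) (R : ℝ) (M : ℕ) (A : Finset ℕ) :
    ∫ t in cantorIterate n (Real.pi * R ^ 2) M A, gammaDensity 0 t ≤
      ‖cantorLocalizationOp n R M A‖ :=
  (radialEigenvalue_cantorIterate n M A 0).symm.trans_le <|
    radialEigenvalue_zero_le_norm (isCompact_cantorIterate n (R ^ 2) M A).measurableSet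
      (isCompact_sphericalCantor n R M A) _

/-! ### Scale of the norms and the estimates of the theorem -/

/-- The asymptotic size `(m / M)ⁿ L ^ (1 - log m / log M)` of the operator norms. -/
noncomputable def normScale (M m n : ℕ) (L : ℝ) : ℝ :=
  ((m : ℝ) / M) ^ n * L ^ (1 - Real.log m / Real.log M)

lemma normScale_pos {M m : ℕ} (hm : 0 < m) (hmM : m < M) (n : ℕ) {L : ℝ} (hL : 0 < L) :
    0 < normScale M m n L := by
  have : 0 < M := hm.trans hmM
  unfold normScale
  positivity

lemma rpow_log_div_log {M m : ℕ} (hm : 0 < m) (hM : 1 < M) :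
    (M : ℝ) ^ (Real.log m / Real.log M) = m := by
  have h1 : (0 : ℝ) < M := by exact_mod_cast (by omega : 0 < M)
  have h2 : Real.log M ≠ 0 := (Real.log_pos (by exact_mod_cast hM)).ne'
  have h3 : (0 : ℝ) < m := by exact_mod_cast hm
  rw [Real.rpow_def_of_pos h1, mul_div_cancel₀ _ h2, Real.exp_log h3]

lemma pow_rpow_log_div_log {M m : ℕ} (hm : 0 < m) (hM : 1 < M) (j : ℕ) :
    ((M : ℝ) ^ j) ^ (Real.log m / Real.log M) = (m : ℝ) ^ j := by
  rw [← Real.rpow_natCast, ← Real.rpow_mul (by positivity), mul_comm, Real.rpow_mul (by positivity),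
    rpow_log_div_log hm hM, Real.rpow_natCast]

lemma log_div_log_nonneg (M m : ℕ) : 0 ≤ Real.log m / Real.log M :=
  div_nonneg (Real.log_natCast_nonneg m) (Real.log_natCast_nonneg M)

/-- Because `M ^ (log m / log M) = m`, the bound on `L` gives `L ^ (log m / log M) ≤ m ^ (j + 1)`;
the extra factor `m` is the cost of rounding to a power of `M`. -/
lemma div_pow_le_normScale {M m : ℕ} (hm : 0 < m) (hmM : m < M) (n : ℕ) {j : ℕ} {L : ℝ}
    (hL : 0 < L) (hj : L < (M : ℝ) ^ (j + 1)) :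
    ((m : ℝ) / M) ^ n * (L / (m : ℝ) ^ j) ≤ m * normScale M m n L := by
  have hM : 1 < M := by omega
  have hm0 : (0 : ℝ) < m := by exact_mod_cast hm
  have h1 : L ^ (Real.log m / Real.log M) ≤ (m : ℝ) ^ (j + 1) := by
    rw [← pow_rpow_log_div_log hm hM]
    exact Real.rpow_le_rpow hL.le hj.le (log_div_log_nonneg M m)
  have h2 : L / (m : ℝ) ^ j ≤ m * L ^ (1 - Real.log m / Real.log M) := by
    rw [Real.rpow_sub hL, Real.rpow_one, ← mul_div_assoc,
      div_le_div_iff₀ (by positivity) (Real.rpow_pos_of_pos hL _)]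
    calc L * L ^ (Real.log m / Real.log M) ≤ L * (m : ℝ) ^ (j + 1) := by gcongr
      _ = m * L * (m : ℝ) ^ j := by ring
  rw [normScale, mul_left_comm]
  gcongr

lemma normScale_le_div_pow {M m : ℕ} (hm : 0 < m) (hmM : m < M) (n : ℕ) {j : ℕ} {L : ℝ}
    (hL : 0 < L) (hj : (M : ℝ) ^ j ≤ L) :
    normScale M m n L ≤ ((m : ℝ) / M) ^ n * (L / (m : ℝ) ^ j) := by
  have hM : 1 < M := by omega
  have hm0 : (0 : ℝ) < m := by exact_mod_cast hm
  have h1 : (m : ℝ) ^ j ≤ L ^ (Real.log m / Real.log M) := by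
    rw [← pow_rpow_log_div_log hm hM]
    exact Real.rpow_le_rpow (by positivity) hj (log_div_log_nonneg M m)
  rw [normScale, Real.rpow_sub hL, Real.rpow_one]
  gcongr

/-- The mean-plus-variation bound at coarse level `i`, with total mass 1 in the mean term. The level
is left free: it balances coarse length against variation. -/
lemma setIntegral_cantorIterate_gammaDensity_le {M m n i : ℕ} {A : Finset ℕ}
    (hA : A ⊆ range M) (hm : A.card = m) (hm0 : 0 < m) (hM : 0 < M) (hi : i ≤ n) {L V : ℝ}
    (hL : 0 < L) (k : ℕ) (hV : ∫ t in cantorIterate i L M A, |gammaDensityDeriv k t| ≤ V) :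
    ∫ t in cantorIterate n L M A, gammaDensity k t ≤
      ((m : ℝ) / M) ^ n * (L / (m : ℝ) ^ i) * ((M : ℝ) ^ i / L + V) := by
  obtain ⟨q, rfl⟩ := Nat.exists_eq_add_of_le hi
  have hm1 : (0 : ℝ) < m := by exact_mod_cast hm0
  have hM1 : (0 : ℝ) < M := by exact_mod_cast hM
  refine (setIntegral_cantorIterate_le hA hM hL (hasDerivAt_gammaDensity k)
    (continuous_gammaDensityDeriv k)).trans ?_
  have h1 : ∫ t in cantorIterate i L M A, gammaDensity k t ≤ 1 :=
    (setIntegral_le_of_subset_Ici (cantorIterate_subset_Ici i hL.le M A)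
      (integrableOn_gammaDensity k) fun s hs => gammaDensity_nonneg k hs).trans_eq
      (integral_gammaDensity k)
  have h2 : L / (M : ℝ) ^ (i + q) * (A.card : ℝ) ^ q =
      ((m : ℝ) / M) ^ (i + q) * (L / (m : ℝ) ^ i) := by
    rw [hm, div_pow, pow_add (m : ℝ)]
    field_simp
  rw [h2]
  refine mul_le_mul_of_nonneg_left (add_le_add ?_ hV) (by positivity)
  rw [inv_div]
  exact mul_le_of_le_one_right (by positivity) h1

lemma norm_cantorLocalizationOp_le_normScale {M m n : ℕ} (hm : 0 < m) (hmM : m < M)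
    {A : Finset ℕ} (hA : A ⊆ range M) (hcard : A.card = m) {R : ℝ} (hR : 0 < R)
    (hRn : Real.pi * R ^ 2 ≤ (M : ℝ) ^ n) :
    ‖cantorLocalizationOp n R M A‖ ≤ 3 * m * normScale M m n (Real.pi * R ^ 2) := by
  have hL : 0 < Real.pi * R ^ 2 := by positivity
  have hm1 : (1 : ℝ) ≤ m := by exact_mod_cast hm
  have hM1 : (1 : ℝ) < M := by exact_mod_cast (by omega : 1 < M)
  have hs := normScale_pos hm hmM n hL
  refine norm_cantorLocalizationOp_le n R M A (by positivity) fun k => ?_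
  set L := Real.pi * R ^ 2
  -- For `L < 1` the bound `γ_k ≤ 1` and the measure of the set suffice, since the exponent of `L`
  -- is at most 1.
  rcases lt_or_ge L 1 with hL1 | hL1
  · have h1 : ∫ t in cantorIterate n L M A, gammaDensity k t ≤ ((m : ℝ) / M) ^ n * L := by
      rw [setIntegral_cantorIterate n hL.le M A (continuous_gammaDensity k)]
      have hb : ∀ x ∈ cantorFinset n M A, ∫ t in (L / (M : ℝ) ^ n * x)..(L / (M : ℝ) ^ n * (x + 1)),
          gammaDensity k t ≤ L / (M : ℝ) ^ n := fun x _ => by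
        have hd : 0 < L / (M : ℝ) ^ n := by positivity
        have h := intervalIntegral.integral_mono_on
          (a := L / (M : ℝ) ^ n * x) (b := L / (M : ℝ) ^ n * (x + 1)) (by nlinarith)
          ((continuous_gammaDensity k).intervalIntegrable (μ := volume) _ _)
          ((continuous_const (y := (1 : ℝ))).intervalIntegrable (μ := volume) _ _)
          fun t ht => gammaDensity_le_one k (le_trans (by positivity) ht.1)
        rw [intervalIntegral.integral_const, smul_eq_mul, mul_one] at h
        linarith
      refine (sum_le_sum hb).trans_eq ?_
      rw [sum_const, card_cantorFinset n hA, hcard, nsmul_eq_mul, div_pow]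
      push_cast
      ring
    have h2 : L ≤ L ^ (1 - Real.log m / Real.log M) := by
      conv_lhs => rw [← Real.rpow_one L]
      exact Real.rpow_le_rpow_of_exponent_ge hL hL1.le (by linarith [log_div_log_nonneg M m])
    have h3 : ((m : ℝ) / M) ^ n * L ≤ normScale M m n L := by
      rw [normScale]
      gcongr
    nlinarith
  -- Level `j` has intervals of length in `[1, M)`, and `πR² ≤ M^n` ensures `j ≤ n`. The mean term
  -- is at most 1 and the variation at most 2, whence the factor 3.
  · obtain ⟨j, hj1, hj2⟩ := exists_nat_pow_near hL1 hM1
    have hjn : j ≤ n := (pow_le_pow_iff_right₀ hM1).1 (hj1.trans hRn)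
    have hV : ∫ t in cantorIterate j L M A, |gammaDensityDeriv k t| ≤ 2 :=
      (setIntegral_le_of_subset_Ici (cantorIterate_subset_Ici j hL.le M A)
        (integrableOn_abs_gammaDensityDeriv k) fun _ _ => abs_nonneg _).trans
        (integral_abs_gammaDensityDeriv_le_two k)
    have h1 := setIntegral_cantorIterate_gammaDensity_le hA hcard hm (by omega) hjn hL k hV
    have h2 : (M : ℝ) ^ j / L ≤ 1 := (div_le_one hL).2 hj1
    have h3 := div_pow_le_normScale hm hmM n hL hj2
    have h4 : 0 ≤ ((m : ℝ) / M) ^ n * (L / (m : ℝ) ^ j) := by positivity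
    nlinarith

lemma normScale_le_norm_cantorLocalizationOp {M m n : ℕ} (hm : 0 < m) (hmM : m < M) {R : ℝ}
    (hR : 1 ≤ Real.pi * R ^ 2) (hRn : Real.pi * R ^ 2 ≤ (M : ℝ) ^ n) :
    Real.exp (-M) * normScale M m n (Real.pi * R ^ 2) ≤
      ‖cantorLocalizationOp n R M (canonicalAlphabet m)‖ := by
  refine le_trans ?_ (le_norm_cantorLocalizationOp n R M (canonicalAlphabet m))
  set L := Real.pi * R ^ 2
  have hL : 0 < L := by linarith
  have hm1 : (0 : ℝ) < m := by exact_mod_cast hm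
  have hM1 : (1 : ℝ) < M := by exact_mod_cast (by omega : 1 < M)
  obtain ⟨j, hj1, hj2⟩ := exists_nat_pow_near hR hM1
  have hjn : j ≤ n := (pow_le_pow_iff_right₀ hM1).1 (hj1.trans hRn)
  obtain ⟨q, rfl⟩ := Nat.exists_eq_add_of_le hjn
  have hA : canonicalAlphabet m ⊆ range M := range_subset_range.2 hmM.le
  have h0 : 0 ∈ canonicalAlphabet m := mem_range.2 hm
  have hd : 0 < L / (M : ℝ) ^ (j + q) := by positivity
  rw [setIntegral_cantorIterate _ hL.le _ _ (continuous_gammaDensity 0)]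
  have hnn : ∀ x ∈ cantorFinset (j + q) M (canonicalAlphabet m),
      x ∉ cantorFinset q M (canonicalAlphabet m) →
      0 ≤ ∫ t in (L / (M : ℝ) ^ (j + q) * x)..(L / (M : ℝ) ^ (j + q) * (x + 1)),
        gammaDensity 0 t := fun x _ _ =>
    intervalIntegral.integral_nonneg (by nlinarith) fun t ht =>
      gammaDensity_nonneg 0 (le_trans (by positivity) ht.1)
  -- Only points with `j` leading zeros are kept: there are `m ^ q` of them, with intervals ending
  -- below `L / M ^ j ≤ M`.
  refine le_trans ?_ (sum_le_sum_of_subset_of_nonneg (cantorFinset_mono h0 (by omega)) hnn)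
  have hb : ∀ x ∈ cantorFinset q M (canonicalAlphabet m),
      L / (M : ℝ) ^ (j + q) * Real.exp (-M) ≤
      ∫ t in (L / (M : ℝ) ^ (j + q) * x)..(L / (M : ℝ) ^ (j + q) * (x + 1)),
        gammaDensity 0 t := fun x hx => by
    have hx' : (x : ℝ) + 1 ≤ (M : ℝ) ^ q := by exact_mod_cast lt_of_mem_cantorFinset hA hx
    have hle : L / (M : ℝ) ^ (j + q) * (x + 1) ≤ M := by
      calc L / (M : ℝ) ^ (j + q) * (x + 1) ≤ L / (M : ℝ) ^ (j + q) * (M : ℝ) ^ q := by gcongr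
        _ = L / (M : ℝ) ^ j := by rw [pow_add]; field_simp
        _ ≤ M := by
          rw [div_le_iff₀ (by positivity), ← pow_succ']
          exact hj2.le
    have h := intervalIntegral.integral_mono_on
      (a := L / (M : ℝ) ^ (j + q) * x) (b := L / (M : ℝ) ^ (j + q) * (x + 1)) (by nlinarith)
      ((continuous_const (y := Real.exp (-M))).intervalIntegrable (μ := volume) _ _)
      ((continuous_gammaDensity 0).intervalIntegrable (μ := volume) _ _)
      fun t ht => by
        simp only [gammaDensity, pow_zero, Nat.factorial_zero, Nat.cast_one, div_one, one_mul]
        exact Real.exp_le_exp.2 (by linarith [ht.2])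
    rw [intervalIntegral.integral_const, smul_eq_mul] at h
    refine le_trans (le_of_eq ?_) h
    ring
  refine le_trans ?_ (sum_le_sum hb)
  rw [sum_const, card_cantorFinset q hA, canonicalAlphabet, card_range, nsmul_eq_mul]
  refine le_trans (mul_le_mul_of_nonneg_left (normScale_le_div_pow hm hmM (j + q) hL hj1)
    (Real.exp_pos _).le) (le_of_eq ?_)
  rw [div_pow, pow_add (m : ℝ)]
  push_cast
  field_simp

lemma reverseAlphabet_subset (M m : ℕ) : reverseAlphabet M m ⊆ range M := fun x hx => by
  rw [reverseAlphabet, mem_Ico] at hx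
  exact mem_range.2 hx.2

lemma card_reverseAlphabet {M m : ℕ} (hmM : m ≤ M) : (reverseAlphabet M m).card = m := by
  rw [reverseAlphabet, Nat.card_Ico]
  omega

lemma norm_cantorLocalizationOp_reverseAlphabet_le {M m : ℕ} (hm : 0 < m) (hmM : m < M) (q : ℕ)
    {n : ℕ} {R : ℝ} (hR : (M : ℝ) ^ (q + 1) ≤ Real.pi * R ^ 2)
    (hRn : Real.pi * R ^ 2 ≤ (M : ℝ) ^ n) :
    ‖cantorLocalizationOp n R M (reverseAlphabet M m)‖ ≤
      m * (((m : ℝ) / M) ^ q + (m : ℝ) ^ q * tailVariation (Real.pi * R ^ 2 / M)) *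
        normScale M m n (Real.pi * R ^ 2) := by
  set L := Real.pi * R ^ 2 with hLdef
  have hm1 : (0 : ℝ) < m := by exact_mod_cast hm
  have hM1 : (1 : ℝ) < M := by exact_mod_cast (by omega : 1 < M)
  have hL1 : 1 ≤ L := (one_le_pow₀ hM1.le).trans hR
  have hL : 0 < L := by linarith
  have hs := normScale_pos hm hmM n hL
  have hη : 0 ≤ tailVariation (L / M) := by
    unfold tailVariation
    positivity
  refine norm_cantorLocalizationOp_le n R M _ (by positivity) fun k => ?_
  rw [← hLdef]
  obtain ⟨j, hj1, hj2⟩ := exists_nat_pow_near hL1 hM1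
  have hjn : j ≤ n := (pow_le_pow_iff_right₀ hM1).1 (hj1.trans hRn)
  have hqj : q + 1 < j + 1 := (pow_lt_pow_iff_right₀ hM1).1 (hR.trans_lt hj2)
  -- The comparison level is `q` steps coarser than the natural one, so its intervals have length at
  -- least `M ^ q`; the remaining `i + 1 ≥ 1` digits keep the coarse iterate inside `[L/M, ∞)`.
  obtain ⟨i, rfl⟩ : ∃ i, j = i + 1 + q := ⟨j - q - 1, by omega⟩
  have hV : ∫ t in cantorIterate (i + 1) L M (reverseAlphabet M m), |gammaDensityDeriv k t| ≤
      tailVariation (L / M) :=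
    (setIntegral_le_of_subset_Ici (cantorIterate_reverseAlphabet_subset i hL.le hmM)
      ((integrableOn_abs_gammaDensityDeriv k).mono_set (Set.Ioi_subset_Ioi (by positivity)))
      fun _ _ => abs_nonneg _).trans
      (integral_abs_gammaDensityDeriv_le_tailVariation k (by positivity))
  have h1 := setIntegral_cantorIterate_gammaDensity_le (reverseAlphabet_subset M m)
    (card_reverseAlphabet hmM.le) hm (by omega) (by omega : i + 1 ≤ n) hL k hV
  have h3 := div_pow_le_normScale hm hmM n hL hj2
  have h2 : (M : ℝ) ^ (i + 1) / L ≤ 1 / (M : ℝ) ^ q := by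
    rw [div_le_div_iff₀ hL (by positivity), one_mul, ← pow_add]
    exact hj1
  refine h1.trans ?_
  calc ((m : ℝ) / M) ^ n * (L / (m : ℝ) ^ (i + 1)) * ((M : ℝ) ^ (i + 1) / L + tailVariation (L / M))
      ≤ ((m : ℝ) / M) ^ n * (L / (m : ℝ) ^ (i + 1)) *
        (1 / (M : ℝ) ^ q + tailVariation (L / M)) := by gcongr
    _ = ((m : ℝ) / M) ^ n * (L / (m : ℝ) ^ (i + 1 + q)) *
        (((m : ℝ) / M) ^ q + (m : ℝ) ^ q * tailVariation (L / M)) := by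
      rw [pow_add (m : ℝ) (i + 1) q, div_pow (m : ℝ) (M : ℝ) q]
      field_simp
    _ ≤ (m * normScale M m n L) *
        (((m : ℝ) / M) ^ q + (m : ℝ) ^ q * tailVariation (L / M)) := by gcongr
    _ = _ := by ring

lemma tendsto_norm_ratio {M m : ℕ} (hm : 0 < m) (hmM : m < M) {R : ℕ → ℝ}
    (hR : Filter.Tendsto R Filter.atTop Filter.atTop)
    (hRn : ∀ n, Real.pi * R n ^ 2 ≤ (M : ℝ) ^ n) :
    Filter.Tendsto
      (fun n => ‖cantorLocalizationOp n (R n) M (reverseAlphabet M m)‖ *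
        ‖cantorLocalizationOp n (R n) M (canonicalAlphabet m)‖⁻¹)
      Filter.atTop (nhds 0) := by
  have hm1 : (0 : ℝ) < m := by exact_mod_cast hm
  have hM1 : (0 : ℝ) < M := by exact_mod_cast (by omega : 0 < M)
  have hL : Filter.Tendsto (fun n => Real.pi * R n ^ 2) Filter.atTop Filter.atTop :=
    ((Filter.tendsto_pow_atTop two_ne_zero).comp hR).const_mul_atTop Real.pi_pos
  have hη := tendsto_tailVariation.comp (hL.atTop_div_const hM1)
  rw [Metric.tendsto_atTop']
  intro ε hε
  -- Chosen so that `m δ`, divided by the lower constant `exp (-M)`, equals `ε`. The level `q` makes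
  -- the mean term less than `δ/2`, and then large `n` does the same for the variation term.
  set δ := Real.exp (-M) * ε / m with hδ
  have hδ0 : 0 < δ := by positivity
  obtain ⟨q, hq⟩ := exists_pow_lt_of_lt_one (half_pos hδ0)
    ((div_lt_one hM1).2 (by exact_mod_cast hmM) : (m : ℝ) / M < 1)
  have h1 : ∀ᶠ n in Filter.atTop, (m : ℝ) ^ q * tailVariation (Real.pi * R n ^ 2 / M) < δ / 2 := by
    have := (hη.const_mul ((m : ℝ) ^ q)).eventually_lt_const (by rw [mul_zero]; exact half_pos hδ0)
    exact this
  have h2 := hL.eventually_ge_atTop ((M : ℝ) ^ (q + 1))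
  have h3 := hL.eventually_ge_atTop 1
  obtain ⟨N, hN⟩ := Filter.eventually_atTop.1 (h1.and (h2.and h3))
  refine ⟨N, fun n hn => ?_⟩
  obtain ⟨e1, e2, e3⟩ := hN n hn.le
  have hs := normScale_pos hm hmM n (zero_lt_one.trans_le e3)
  have hcan := normScale_le_norm_cantorLocalizationOp hm hmM e3 (hRn n)
  have hrev := norm_cantorLocalizationOp_reverseAlphabet_le hm hmM q e2 (hRn n)
  have hpos := (mul_pos (Real.exp_pos (-M)) hs).trans_le hcan
  rw [Real.dist_eq, sub_zero, abs_of_nonneg (by positivity), ← div_eq_mul_inv, div_lt_iff₀ hpos]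
  calc _ ≤ _ := hrev
    _ < m * δ * normScale M m n (Real.pi * R n ^ 2) := by
      gcongr
      linarith
    _ = ε * (Real.exp (-M) * normScale M m n (Real.pi * R n ^ 2)) := by
      rw [hδ]
      field_simp
    _ ≤ _ := by gcongr

end Daubechies

theorem mainTheorem3 (M m : ℕ) (hm : 0 < m) (hmM : m < M) :
    ∃ BL BU : ℝ, 0 < BL ∧ BL ≤ BU ∧
      ∀ R : ℕ → ℝ, (∀ n, 0 < R n) → Filter.Tendsto R Filter.atTop Filter.atTop →
        (∀ n, Real.pi * R n ^ 2 ≤ (M : ℝ) ^ n) →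
        (∀ A : Finset ℕ, A ⊆ Finset.range M → A.card = m → ∀ n,
          ‖Daubechies.cantorLocalizationOp n (R n) M A‖ ≤
            BU * ((m : ℝ) / M) ^ n *
              (Real.pi * R n ^ 2) ^ (1 - Real.log m / Real.log M)) ∧
        (∀ n, 1 ≤ Real.pi * R n ^ 2 →
          BL * ((m : ℝ) / M) ^ n *
              (Real.pi * R n ^ 2) ^ (1 - Real.log m / Real.log M) ≤
            ‖Daubechies.cantorLocalizationOp n (R n) M (Daubechies.canonicalAlphabet m)‖) ∧
        (Daubechies.reverseAlphabet M m ⊆ Finset.range M ∧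
          (Daubechies.reverseAlphabet M m).card = m ∧
          Filter.Tendsto
            (fun n =>
              ‖Daubechies.cantorLocalizationOp n (R n) M (Daubechies.reverseAlphabet M m)‖ *
                ‖Daubechies.cantorLocalizationOp n (R n) M
                  (Daubechies.canonicalAlphabet m)‖⁻¹)
            Filter.atTop (nhds 0)) := by
  -- The lower constant is the minimum of `e^{-s}` on `[0, M]`; in the upper one, 3 is mass plus
  -- variation and `m` is the rounding loss.
  refine ⟨Real.exp (-M), 3 * m, Real.exp_pos _, ?_, fun R hR0 hR hRn =>
    ⟨fun A hA hcard n => ?_, fun n hn => ?_, Daubechies.reverseAlphabet_subset M m,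
      Daubechies.card_reverseAlphabet hmM.le, Daubechies.tendsto_norm_ratio hm hmM hR hRn⟩⟩
  · have h1 : Real.exp (-M) ≤ 1 := Real.exp_le_one_iff.2 (neg_nonpos.2 M.cast_nonneg)
    have h2 : (1 : ℝ) ≤ m := by exact_mod_cast hm
    linarith
  · rw [mul_assoc]
    exact Daubechies.norm_cantorLocalizationOp_le_normScale hm hmM hA hcard (hR0 n) (hRn n)
  · rw [mul_assoc]
    exact Daubechies.normScale_le_norm_cantorLocalizationOp hm hmM hn (hRn n)
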